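/- Let $\mathbb{F}_2^n$ be the space of binary vectors of length $n$ with $\langle x,y\rangle=x_1y_1\oplus\dots\oplus x_ny_n$, and identify $\mathbb{F}_2^{2n}$ with the set of pairs $(x,y)$, $x,y\in\mathbb{F}_2^n$. The Maiorana--McFarland class $\mathcal{M}_{2n}$ consists of all (bent) functions $f_{\pi,\varphi}(x,y)=\langle x,\pi(y)\rangle\oplus\varphi(y)$, where $\pi$ is a permutation of $\mathbb{F}_2^n$ and $\varphi:\mathbb{F}_2^n\to\mathbb{F}_2$. A function is called affine on an affine subspace if its restriction to it coincides with the restriction of an affine map; $1_S$ is the characteristic function of a set $S$. For $f:\mathbb{F}_2^{2n}\to\mathbb{F}_2$ let $$N(f)=\{f\oplus 1_U:\ U\subseteq\mathbb{F}_2^{2n}\text{ an affine subspace},\ \dim U=n,\ f\text{ is affine on }U\},$$ $$\mathcal{M}^{sp}_{2n}=\bigcup_{f\in\mathcal{M}_{2n}}N(f),\qquad N(\mathcal{M}_{2n})=\mathcal{M}^{sp}_{2n}\setminus\mathcal{M}_{2n}$$ (the set $N(\mathcal{M}_{2n})$ is called the set of all closest bent functions to the class $\mathcal{M}_{2n}$).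 For $0\le k\le n$ put $$\rho(n,k)=2^{2(n-k)}\left(\prod_{i=0}^{k-1}\frac{2^n-2^i}{2^k-2^i}\right)^{2}\frac{(2^k)!\,(2^n-2^k)!}{(2^n)!}.$$ **Theorem.** $|N(\mathcal{M}_2)|=0$, and for all $n\ge 2$ $$|N(\mathcal{M}_{2n})|=\Big(\tfrac43\rho(n,2)+\sum_{k=3}^{n}\rho(n,k)\,2^{(k+1)^2-2^k}\Big)|\mathcal{M}_{2n}|.$$ Moreover, $|\mathcal{M}^{sp}_{2n}|=|N(\mathcal{M}_{2n})|+|\mathcal{M}_{2n}|$ for all $n\ge 1$, so this gives $|\mathcal{M}^{sp}_{2n}|$ exactly. Finally, the two-dimensional subspaces contribute exactly $\frac43\rho(n,2)|\mathcal{M}_{2n}|$ functions for $n\ge2$, in the following sense. Fix for every linear subspace $R\subseteq\mathbb{F}_2^n$ an information set $I(R)\subseteq\{1,\dots,n\}$, i.e. a set of $\dim R$ coordinates such that the projection of $R$ to them is onto. Let $x_I$ be the subvector of $x$ with the coordinates from $I$, and for $v\in\mathbb{F}_2^I$ let $v^I\in\mathbb{F}_2^n$ be its extension by zero. Then the set of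 all functions $$f_{\pi,\varphi}\oplus 1_S,\qquad S=\{(H(y)^I\oplus z,\,y):\ y\in L,\ z\in R^\perp\},$$ where $f_{\pi,\varphi}\in\mathcal{M}_{2n}$, both $L$ and $\pi(L)$ are $2$-dimensional affine subspaces of $\mathbb{F}_2^n$, $R=b\oplus\pi(L)$ with $b\in\pi(L)$ is the linear subspace parallel to $\pi(L)$, $I=I(R)$, and both $H:L\to\mathbb{F}_2^I$ and $y\in L\mapsto\langle H(y),\pi(y)_I\rangle\oplus\varphi(y)$ are affine, is a subset of $N(\mathcal{M}_{2n})$ of cardinality $\frac43\rho(n,2)\,|\mathcal{M}_{2n}|$. -/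

import Mathlib

noncomputable section

namespace MMBent

/-- The vector space of binary vectors of length `n`. The space of `2n` binary variables is used
in the form `F2Vec n × F2Vec n`, with points `(x, y)`. -/
abbrev F2Vec (n : ℕ) : Type := Fin n → ZMod 2

/-- The characteristic Boolean function of a set. -/
def charFun {E : Type*} (S : Set E) : E → ZMod 2 := S.indicator 1

/-- The `k`-dimensional (nonempty) affine subspaces. -/
def AffSub (E : Type*) [AddCommGroup E] [Module (ZMod 2) E] (k : ℕ) :
    Set (AffineSubspace (ZMod 2) E) :=
  {U | (U : Set E).Nonempty ∧ Module.finrank (ZMod 2) U.direction = k}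

/-- `f` is affine on `U`: its restriction to `U` is the restriction of an affine map. -/
def AffineOn {E W : Type*} [AddCommGroup E] [Module (ZMod 2) E] [AddCommGroup W]
    [Module (ZMod 2) W] (f : E → W) (U : Set E) : Prop :=
  ∃ F : E →ᵃ[ZMod 2] W, Set.EqOn f F U

/-- All `f ⊕ 1_U` where `U` is an `n`-dimensional affine subspace of the space of `2n` variables
on which `f` is affine. -/
def near {n : ℕ} (f : F2Vec n × F2Vec n → ZMod 2) : Set (F2Vec n × F2Vec n → ZMod 2) :=
  {g | ∃ U ∈ AffSub (F2Vec n × F2Vec n) n,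
    AffineOn f (U : Set (F2Vec n × F2Vec n)) ∧ g = f + charFun (U : Set (F2Vec n × F2Vec n))}

/-- The class generated from `K` by the construction `f ⊕ 1_U`. -/
def spClass {n : ℕ} (K : Set (F2Vec n × F2Vec n → ZMod 2)) :
    Set (F2Vec n × F2Vec n → ZMod 2) :=
  ⋃ f ∈ K, near f

/-- The set of all closest bent functions to the class `K`: the functions generated from `K` by
the construction `f ⊕ 1_U` that do not belong to `K`. -/
def nearClass {n : ℕ} (K : Set (F2Vec n × F2Vec n → ZMod 2)) :
    Set (F2Vec n × F2Vec n → ZMod 2) :=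
  (⋃ f ∈ K, near f) \ K

/-- The Maiorana--McFarland function `(x, y) ↦ ⟨x, π(y)⟩ ⊕ φ(y)`. -/
def mmFun {n : ℕ} (π : Equiv.Perm (F2Vec n)) (φ : F2Vec n → ZMod 2) :
    F2Vec n × F2Vec n → ZMod 2 :=
  fun p => p.1 ⬝ᵥ π p.2 + φ p.2

/-- The Maiorana--McFarland class in `2n` variables. -/
def MM (n : ℕ) : Set (F2Vec n × F2Vec n → ZMod 2) :=
  {f | ∃ π φ, f = mmFun π φ}

/-- The Gaussian binomial coefficient: the number of `k`-dimensional linear subspaces of the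
space of dimension `n` over the field of two elements (the product vanishes for `k > n`). -/
def gaussBinom (n k : ℕ) : ℚ :=
  ∏ i ∈ Finset.range k, ((2 : ℚ) ^ n - 2 ^ i) / ((2 : ℚ) ^ k - 2 ^ i)

/-- `ρ(n, k)`, meaningful for `k ≤ n`. -/
def rho (n k : ℕ) : ℚ :=
  2 ^ (2 * (n - k)) * gaussBinom n k ^ 2 * (Nat.factorial (2 ^ k) : ℚ) *
    (Nat.factorial (2 ^ n - 2 ^ k) : ℚ) / (Nat.factorial (2 ^ n) : ℚ)

/-- `I` is an information set of the linear subspace `R`: `|I| = dim R`, and the projection of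
`R` to the coordinates from `I` is onto. -/
def IsInfoSet {n : ℕ} (I : Finset (Fin n)) (R : Submodule (ZMod 2) (F2Vec n)) : Prop :=
  I.card = Module.finrank (ZMod 2) R ∧
    ∀ v : I → ZMod 2, ∃ x ∈ R, ∀ i : I, x i = v i

/-- The subvector of `x` with the coordinates from `I`. -/
def restr {n : ℕ} (I : Finset (Fin n)) (x : F2Vec n) : I → ZMod 2 := fun i => x i

/-- Extension by zero from the coordinates in `I` to all coordinates. -/
def coords {n : ℕ} (I : Finset (Fin n)) (v : I → ZMod 2) : F2Vec n :=
  fun i => if h : i ∈ I then v ⟨i, h⟩ else 0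

/-- The orthogonal of a linear subspace with respect to the standard inner product. -/
def orth {n : ℕ} (R : Submodule (ZMod 2) (F2Vec n)) : Set (F2Vec n) :=
  {y | ∀ x ∈ R, x ⬝ᵥ y = 0}

/-- `S_k(π)`: the `k`-dimensional affine subspaces that `π` maps onto `k`-dimensional affine
subspaces. -/
def permSub {n : ℕ} (k : ℕ) (π : Equiv.Perm (F2Vec n)) :
    Set (AffineSubspace (ZMod 2) (F2Vec n)) :=
  {L | L ∈ AffSub (F2Vec n) k ∧
    ∃ M ∈ AffSub (F2Vec n) k, (M : Set (F2Vec n)) = π '' (L : Set (F2Vec n))}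

/-- The linear subspace of which `π(L)` is a translate, if `π(L)` is an affine subspace. -/
def imageDir {n : ℕ} (π : Equiv.Perm (F2Vec n)) (L : AffineSubspace (ZMod 2) (F2Vec n)) :
    Submodule (ZMod 2) (F2Vec n) :=
  vectorSpan (ZMod 2) (π '' (L : Set (F2Vec n)))

/-- The set of all `(H^I(y) ⊕ z, y)` with `y ∈ L` and `z ∈ R`. Only the values of `H` on `L`
matter. -/
def subspaceConstr {n : ℕ} (L R : Set (F2Vec n)) (I : Finset (Fin n))
    (H : F2Vec n → (I → ZMod 2)) : Set (F2Vec n × F2Vec n) :=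
  {p | ∃ y ∈ L, ∃ z ∈ R, p = (coords I (H y) + z, y)}

/-- The functions generated by the subspaces `L` of dimension `k`: all
`f_{π,φ} ⊕ 1_S` with `S = {(H^I(y) ⊕ z, y) : y ∈ L, z ∈ R^⊥}`, where `L ∈ S_k(π)`, `R` is the
direction of `π(L)`, `I = ι R` is the chosen information set of `R`, and both `H` and
`y ↦ ⟨H(y), π_I(y)⟩ ⊕ φ(y)` are affine on `L`. -/
def nearDim {n : ℕ} (ι : Submodule (ZMod 2) (F2Vec n) → Finset (Fin n)) (k : ℕ) :
    Set (F2Vec n × F2Vec n → ZMod 2) :=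
  {g | ∃ (π : Equiv.Perm (F2Vec n)) (φ : F2Vec n → ZMod 2),
    ∃ L ∈ permSub k π, ∃ H : F2Vec n → (ι (imageDir π L) → ZMod 2),
      AffineOn H (L : Set (F2Vec n)) ∧
      AffineOn (fun y => H y ⬝ᵥ restr (ι (imageDir π L)) (π y) + φ y) (L : Set (F2Vec n)) ∧
      g = mmFun π φ +
        charFun (subspaceConstr (L : Set (F2Vec n)) (orth (imageDir π L)) (ι (imageDir π L)) H)}

end MMBent

end

/-! Let `f = mmFun π φ` be affine on an `n`-dimensional `U`, let `L` be the projection of `U` to the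
`y`-space and `k = dim L`. The fibres of `U` over `L` have a common direction `R` of dimension `n -
k`. Affinity of `f` forces `⟨z, π(y)⟩` to be constant on `L` for each `z ∈ R`, so `π(L)` lies in a
translate of `R^⊥`; that translate has `2 ^ k` points, hence `π(L)` fills it. Thus `f ⊕ 1_U` is
encoded by a `Datum`: `L`, `M = π(L)`, the bijection `α` between them in coordinates, an affine map
`h` placing the fibres, an affine function `G` prescribing `φ` on `L`, and extensions of `π` and `φ`
off `L` (`near_subset`, with converse `nearFrame_subset_spClass`).

Over a point of `L`, the function is, up to an affine function of `x` depending only on `M` and a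
constant, a linear function of `k` coordinates plus the indicator of one point. For `k ≤ 1` this is
affine and nothing leaves the class. For `k ≥ 2` it is not, so the function leaves the class and
determines `L`; different `k` give disjoint sets (`nearClass_eq`, `nearFrame_disjoint`).

For `k ≥ 3` the point and the linear function are unique, so the whole datum can be recovered
(`Datum.fn_injective`), and counting data gives `ρ(n,k) 2^((k+1)^2 - 2^k) |MM|`. For `k = 2` moving
the point compensates any change of the linear function, so all 24 bijections `α` give the same
functions as `α = 1` (`nearFrame_two_eq`). With `α = 1` the datum is unique, and the factor becomes
`2^(9-4) / 24 = 4/3`. -/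

noncomputable section

namespace MMBent

open Module

/-! ### Transposes with respect to the standard inner products. -/

section Transpose

variable {n k : ℕ}

/-- The transpose of a linear map with respect to the standard inner products. -/
def tr (ρ : F2Vec k →ₗ[ZMod 2] F2Vec n) : F2Vec n →ₗ[ZMod 2] F2Vec k :=
  (LinearMap.toMatrix' ρ).vecMulLinear

theorem tr_dot (ρ : F2Vec k →ₗ[ZMod 2] F2Vec n) (x : F2Vec n) (w : F2Vec k) :
    tr ρ x ⬝ᵥ w = x ⬝ᵥ ρ w := by
  conv_rhs => rw [← LinearMap.toMatrix'_mulVec ρ w]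
  rw [Matrix.dotProduct_mulVec]
  rfl

theorem tr_surjective {ρ : F2Vec k →ₗ[ZMod 2] F2Vec n} (hρ : Function.Injective ρ) :
    Function.Surjective (tr ρ) := by
  -- The transpose of a left inverse of `ρ` is a right inverse of `tr ρ`.
  obtain ⟨g, hg⟩ := ρ.exists_leftInverse_of_injective (LinearMap.ker_eq_bot.2 hρ)
  refine fun c => ⟨tr g c, dotProduct_eq _ _ fun w => ?_⟩
  rw [tr_dot, tr_dot, ← LinearMap.comp_apply, hg, LinearMap.id_apply]

theorem tr_eq_zero_iff {ρ : F2Vec k →ₗ[ZMod 2] F2Vec n} {x : F2Vec n} :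
    tr ρ x = 0 ↔ ∀ w, x ⬝ᵥ ρ w = 0 := by
  refine ⟨fun h w => by rw [← tr_dot, h, zero_dotProduct], fun h => dotProduct_eq _ _ fun w => ?_⟩
  rw [tr_dot, h, zero_dotProduct]

theorem finrank_ker_tr {ρ : F2Vec k →ₗ[ZMod 2] F2Vec n} (hρ : Function.Injective ρ) :
    finrank (ZMod 2) (LinearMap.ker (tr ρ)) + k = n := by
  have := (tr ρ).finrank_range_add_finrank_ker
  rw [LinearMap.range_eq_top.2 (tr_surjective hρ), finrank_top, finrank_fin_fun,
    finrank_fin_fun] at this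
  omega

end Transpose

/-! ### Affinity on the image of an injective affine map. -/

section Affine

variable {E W : Type*} [AddCommGroup E] [Module (ZMod 2) E] [AddCommGroup W] [Module (ZMod 2) W]
variable {A : Type*} [AddCommGroup A] [Module (ZMod 2) A]

theorem AffineMap.decomp_zero (e : A →ᵃ[ZMod 2] E) (t : A) : e t = e.linear t + e 0 := by
  simpa using e.map_vadd 0 t

theorem exists_affine_leftInverse {e : A →ᵃ[ZMod 2] E} (he : Function.Injective e) :
    ∃ g : E →ᵃ[ZMod 2] A, ∀ t, g (e t) = t := by
  obtain ⟨g, hg⟩ := e.linear.exists_leftInverse_of_injective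
    (LinearMap.ker_eq_bot.2 (e.linear_injective_iff.2 he))
  refine ⟨g.toAffineMap - AffineMap.const _ _ (g (e 0)), fun t => ?_⟩
  have := LinearMap.congr_fun hg t
  simp only [LinearMap.comp_apply, LinearMap.id_apply] at this
  simp [AffineMap.decomp_zero e t, this]

theorem affineOn_iff_of_range {e : A →ᵃ[ZMod 2] E} (he : Function.Injective e) {U : Set E}
    (hU : Set.range e = U) (f : E → W) :
    AffineOn f U ↔ ∃ G : A →ᵃ[ZMod 2] W, ∀ t, f (e t) = G t := by
  subst hU
  constructor
  · rintro ⟨F, hF⟩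
    exact ⟨F.comp e, fun t => hF ⟨t, rfl⟩⟩
  · rintro ⟨G, hG⟩
    obtain ⟨g, hg⟩ := exists_affine_leftInverse he
    refine ⟨G.comp g, ?_⟩
    rintro _ ⟨t, rfl⟩
    simp [hG, hg]

theorem affSub_of_range [Module.Finite (ZMod 2) A] {e : A →ᵃ[ZMod 2] E}
    (he : Function.Injective e) {k : ℕ} (hk : finrank (ZMod 2) A = k) :
    ∃ U ∈ AffSub E k, (U : Set E) = Set.range e := by
  refine ⟨(⊤ : AffineSubspace (ZMod 2) A).map e, ⟨⟨e 0, 0, trivial, rfl⟩, ?_⟩, by simp⟩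
  rw [AffineSubspace.map_direction, AffineSubspace.direction_top, Submodule.map_top,
    LinearMap.finrank_range_of_inj (e.linear_injective_iff.2 he), hk]

end Affine

/-! ### Parametrized affine subspaces and the data behind `f ⊕ 1_U`. -/

section Frames

variable {n k : ℕ}

theorem exists_frame {L : AffineSubspace (ZMod 2) (F2Vec n)} (hL : L ∈ AffSub (F2Vec n) k) :
    ∃ e : F2Vec k →ᵃ[ZMod 2] F2Vec n, Function.Injective e ∧
      Set.range e = (L : Set (F2Vec n)) := by
  obtain ⟨⟨p, hp⟩, hd⟩ := hL
  have eqv : F2Vec k ≃ₗ[ZMod 2] L.direction :=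
    LinearEquiv.ofFinrankEq _ _ (by rw [hd, finrank_fin_fun])
  refine ⟨(L.direction.subtype ∘ₗ eqv.toLinearMap).toAffineMap + AffineMap.const _ _ p, ?_, ?_⟩
  · intro s t h
    simpa using h
  · ext x
    constructor
    · rintro ⟨t, rfl⟩
      exact AffineSubspace.vadd_mem_of_mem_direction (eqv t).2 hp
    · intro hx
      refine ⟨eqv.symm ⟨x - p, AffineSubspace.vsub_mem_direction hx hp⟩, ?_⟩
      simp

/-- A chosen affine parametrization of a `k`-dimensional affine subspace. -/
def frame (L : AffSub (F2Vec n) k) : F2Vec k →ᵃ[ZMod 2] F2Vec n := (exists_frame L.2).choose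

theorem frame_injective (L : AffSub (F2Vec n) k) : Function.Injective (frame L) :=
  (exists_frame L.2).choose_spec.1

theorem range_frame (L : AffSub (F2Vec n) k) :
    Set.range (frame L) = (L.1 : Set (F2Vec n)) :=
  (exists_frame L.2).choose_spec.2

theorem frame_mem (L : AffSub (F2Vec n) k) (t : F2Vec k) : frame L t ∈ L.1 := by
  rw [← SetLike.mem_coe, ← range_frame]
  exact ⟨t, rfl⟩

theorem frame_linear_injective (L : AffSub (F2Vec n) k) :
    Function.Injective (frame L).linear :=
  (frame L).linear_injective_iff.2 (frame_injective L)

theorem range_frame_linear (L : AffSub (F2Vec n) k) :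
    LinearMap.range (frame L).linear = L.1.direction := by
  have h : (⊤ : AffineSubspace (ZMod 2) (F2Vec k)).map (frame L) = L.1 := by
    apply SetLike.coe_injective
    rw [AffineSubspace.coe_map, AffineSubspace.top_coe, Set.image_univ, range_frame]
  rw [← h, AffineSubspace.map_direction, AffineSubspace.direction_top, Submodule.map_top]

theorem affineOn_iff_frame {W : Type*} [AddCommGroup W] [Module (ZMod 2) W]
    (L : AffSub (F2Vec n) k) (f : F2Vec n → W) :
    AffineOn f (L.1 : Set (F2Vec n)) ↔ ∃ G : F2Vec k →ᵃ[ZMod 2] W, ∀ t, f (frame L t) = G t :=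
  affineOn_iff_of_range (frame_injective L) (range_frame L) f

/-- The set of all `(x, y)` for which `y` is the point of `L` with the parameter `t` and `x`
has the coordinates `h t` with respect to the chosen basis of the direction of `M`. -/
def frameSet (L M : AffSub (F2Vec n) k) (h : F2Vec k →ᵃ[ZMod 2] F2Vec k) :
    Set (F2Vec n × F2Vec n) :=
  {p | ∃ t, p.2 = frame L t ∧ tr (frame M).linear p.1 = h t}

theorem mem_frameSet {L M : AffSub (F2Vec n) k} {h : F2Vec k →ᵃ[ZMod 2] F2Vec k} {x : F2Vec n}
    {t : F2Vec k} : (x, frame L t) ∈ frameSet L M h ↔ tr (frame M).linear x = h t := by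
  constructor
  · rintro ⟨s, hs, hx⟩
    rw [frame_injective L hs]
    exact hx
  · exact fun hx => ⟨t, rfl, hx⟩

theorem mem_of_mem_frameSet {L M : AffSub (F2Vec n) k} {h : F2Vec k →ᵃ[ZMod 2] F2Vec k}
    {x y : F2Vec n} (hxy : (x, y) ∈ frameSet L M h) : y ∈ L.1 := by
  obtain ⟨t, ht, -⟩ := hxy
  simp only at ht
  rw [ht]
  exact frame_mem L t

theorem dot_frame (M : AffSub (F2Vec n) k) (x : F2Vec n) (w : F2Vec k) :
    x ⬝ᵥ frame M w = tr (frame M).linear x ⬝ᵥ w + x ⬝ᵥ frame M 0 := by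
  rw [AffineMap.decomp_zero (frame M) w, dotProduct_add, tr_dot]

/-- The data that determine a function near to a Maiorana--McFarland function: affine subspaces
`L` and `M`, a bijection between them that belongs to `B` in coordinates, a permutation `π` that
extends it, an affine map `h` that determines the subspace of `2n` variables, and a function `φ`
for which the resulting Maiorana--McFarland function is affine on this subspace. -/
def Datum (n k : ℕ) (B : Set (Equiv.Perm (F2Vec k))) : Type :=
  Σ c : (AffSub (F2Vec n) k × AffSub (F2Vec n) k) × B × (F2Vec k →ᵃ[ZMod 2] F2Vec k) ×
      (F2Vec k →ᵃ[ZMod 2] ZMod 2),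
    {π : Equiv.Perm (F2Vec n) // ∀ t, π (frame c.1.1 t) = frame c.1.2 (c.2.1.1 t)} ×
      {φ : F2Vec n → ZMod 2 // ∀ t, φ (frame c.1.1 t) = c.2.2.2 t + c.2.2.1 t ⬝ᵥ c.2.1.1 t}

/-- The function determined by a datum. -/
def Datum.fn {n k : ℕ} {B : Set (Equiv.Perm (F2Vec k))} (d : Datum n k B) :
    F2Vec n × F2Vec n → ZMod 2 :=
  mmFun d.2.1 d.2.2 + charFun (frameSet d.1.1.1 d.1.1.2 d.1.2.2.1)

/-- The functions determined by the data of dimension `k`. -/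
def nearFrame (n k : ℕ) (B : Set (Equiv.Perm (F2Vec k))) :
    Set (F2Vec n × F2Vec n → ZMod 2) :=
  Set.range (Datum.fn : Datum n k B → _)

theorem mem_nearFrame {B : Set (Equiv.Perm (F2Vec k))} {g : F2Vec n × F2Vec n → ZMod 2} :
    g ∈ nearFrame n k B ↔ ∃ (L M : AffSub (F2Vec n) k) (α : Equiv.Perm (F2Vec k)) (_ : α ∈ B)
      (h : F2Vec k →ᵃ[ZMod 2] F2Vec k) (G : F2Vec k →ᵃ[ZMod 2] ZMod 2)
      (π : Equiv.Perm (F2Vec n)) (φ : F2Vec n → ZMod 2),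
      (∀ t, π (frame L t) = frame M (α t)) ∧ (∀ t, φ (frame L t) = G t + h t ⬝ᵥ α t) ∧
      g = mmFun π φ + charFun (frameSet L M h) := by
  constructor
  · rintro ⟨⟨⟨⟨L, M⟩, ⟨α, hα⟩, h, G⟩, ⟨π, hπ⟩, φ, hφ⟩, rfl⟩
    exact ⟨L, M, α, hα, h, G, π, φ, hπ, hφ, rfl⟩
  · rintro ⟨L, M, α, hα, h, G, π, φ, hπ, hφ, rfl⟩
    exact ⟨⟨⟨⟨L, M⟩, ⟨α, hα⟩, h, G⟩, ⟨π, hπ⟩, φ, hφ⟩, rfl⟩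

end Frames

/-! ### Characteristic functions and characteristic two. -/

section Char

theorem charFun_of_mem {E : Type*} {S : Set E} {p : E} (h : p ∈ S) : charFun S p = 1 := by
  simp [charFun, h]

theorem charFun_of_notMem {E : Type*} {S : Set E} {p : E} (h : p ∉ S) : charFun S p = 0 := by
  simp [charFun, h]

open Classical in
theorem charFun_eq_ite {E : Type*} (S : Set E) (p : E) : charFun S p = if p ∈ S then 1 else 0 := by
  split_ifs with h
  exacts [charFun_of_mem h, charFun_of_notMem h]

theorem add_self_zmod_two {W : Type*} [AddCommGroup W] [Module (ZMod 2) W] (w : W) :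
    w + w = 0 := by
  rw [← two_smul (ZMod 2) w, show (2 : ZMod 2) = 0 from rfl, zero_smul]

theorem add_eq_zero_iff_zmod_two {W : Type*} [AddCommGroup W] [Module (ZMod 2) W] {v w : W} :
    v + w = 0 ↔ v = w := by
  constructor
  · intro h
    rw [← add_zero v, ← add_self_zmod_two w, ← add_assoc, h, zero_add]
  · rintro rfl
    exact add_self_zmod_two v

end Char

/-! ### Recovering the datum from the slices `x ↦ g (x, y)`. -/

section Slices

variable {n k : ℕ}

/-- The function `x ↦ g (x, y)` is affine. -/
def SliceAffine (g : F2Vec n × F2Vec n → ZMod 2) (y : F2Vec n) : Prop :=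
  ∀ x u v, g (x, y) + g (x + u, y) + g (x + v, y) + g (x + u + v, y) = 0

theorem quad_affine (a x u v : F2Vec n) (c : ZMod 2) :
    (x ⬝ᵥ a + c) + ((x + u) ⬝ᵥ a + c) + ((x + v) ⬝ᵥ a + c) + ((x + u + v) ⬝ᵥ a + c) = 0 := by
  simp only [add_dotProduct]
  generalize x ⬝ᵥ a = p
  generalize u ⬝ᵥ a = q
  generalize v ⬝ᵥ a = r
  revert p q r c
  decide

theorem sliceAffine_mmFun (π : Equiv.Perm (F2Vec n)) (φ : F2Vec n → ZMod 2) (y : F2Vec n) :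
    SliceAffine (mmFun π φ) y :=
  fun x u v => quad_affine (π y) x u v (φ y)

/-- Over `y ∈ L` some plane meets the set in exactly one point, so the sum over this plane is 1. Its
two directions are lifts of two basis vectors under the transpose, which is where `2 ≤ k` enters.
The criterion makes `L` an invariant of the function. -/
theorem not_sliceAffine_iff (hk : 2 ≤ k) (L M : AffSub (F2Vec n) k)
    (h : F2Vec k →ᵃ[ZMod 2] F2Vec k) (π : Equiv.Perm (F2Vec n)) (φ : F2Vec n → ZMod 2)
    (y : F2Vec n) :
    ¬ SliceAffine (mmFun π φ + charFun (frameSet L M h)) y ↔ y ∈ L.1 := by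
  constructor
  · contrapose!
    intro hy x u v
    have hz : ∀ z, charFun (frameSet L M h) (z, y) = 0 :=
      fun z => charFun_of_notMem fun hm => hy (mem_of_mem_frameSet hm)
    simpa [hz] using sliceAffine_mmFun π φ y x u v
  · intro hy hs
    rw [← SetLike.mem_coe, ← range_frame] at hy
    obtain ⟨t, rfl⟩ := hy
    have sur := tr_surjective (frame_linear_injective M)
    obtain ⟨x, hx⟩ := sur (h t)
    obtain ⟨u, hu⟩ := sur (Pi.single ⟨0, by omega⟩ 1)
    obtain ⟨v, hv⟩ := sur (Pi.single ⟨1, by omega⟩ 1)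
    have h0 : charFun (frameSet L M h) (x, frame L t) = 1 :=
      charFun_of_mem (mem_frameSet.2 hx)
    have h1 : charFun (frameSet L M h) (x + u, frame L t) = 0 := by
      refine charFun_of_notMem fun hm => ?_
      rw [mem_frameSet, map_add, hx, hu, add_eq_left] at hm
      simpa using congr_fun hm ⟨0, by omega⟩
    have h2 : charFun (frameSet L M h) (x + v, frame L t) = 0 := by
      refine charFun_of_notMem fun hm => ?_
      rw [mem_frameSet, map_add, hx, hv, add_eq_left] at hm
      simpa using congr_fun hm ⟨1, by omega⟩
    have h3 : charFun (frameSet L M h) (x + u + v, frame L t) = 0 := by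
      refine charFun_of_notMem fun hm => ?_
      rw [mem_frameSet, map_add, map_add, hx, hu, hv, add_assoc, add_eq_left] at hm
      have := congr_fun hm ⟨0, by omega⟩
      simp at this
    have q := sliceAffine_mmFun π φ (frame L t) x u v
    have q' := hs x u v
    simp only [Pi.add_apply, h0, h1, h2, h3, add_zero] at q'
    have : (1 : ZMod 2) = 0 := by linear_combination q' - q
    exact one_ne_zero this

theorem nearFrame_disjoint_MM (hk : 2 ≤ k) (B : Set (Equiv.Perm (F2Vec k))) :
    Disjoint (nearFrame n k B) (MM n) := by
  rw [Set.disjoint_left]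
  intro g hg
  rw [mem_nearFrame] at hg
  obtain ⟨L, M, α, -, h, G, π, φ, -, -, rfl⟩ := hg
  rintro ⟨π', φ', hg⟩
  refine (not_sliceAffine_iff hk L M h π φ (frame L 0)).2 (frame_mem L 0) ?_
  rw [hg]
  exact sliceAffine_mmFun _ _ _

theorem nearFrame_disjoint {k' : ℕ} (hk : 2 ≤ k) (hk' : 2 ≤ k') (hne : k ≠ k')
    (B : Set (Equiv.Perm (F2Vec k))) (B' : Set (Equiv.Perm (F2Vec k'))) :
    Disjoint (nearFrame n k B) (nearFrame n k' B') := by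
  rw [Set.disjoint_left]
  intro g hg hg'
  rw [mem_nearFrame] at hg hg'
  obtain ⟨L, M, α, -, h, G, π, φ, -, -, rfl⟩ := hg
  obtain ⟨L', M', α', -, h', G', π', φ', -, -, e⟩ := hg'
  have hL : L.1 = L'.1 := by
    ext y
    rw [← not_sliceAffine_iff hk L M h π φ y, ← not_sliceAffine_iff hk' L' M' h' π' φ' y, e]
  apply hne
  rw [← L.2.2, ← L'.2.2, hL]

/-- If `h ≠ h'` differ in coordinate `i` and `3 ≤ k`, there are two independent directions that
vanish at `i`. The plane through `h` spanned by them misses `h'`, and summing over it kills the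
affine parts but not the indicator of `h`. In dimension 2 no such plane exists; with `a = a'` the
linear parts cancel and a line through `h` suffices. -/
theorem eq_of_indicator_add_linear (hk : 2 ≤ k) {h h' a a' : F2Vec k} {c : ZMod 2}
    (H : ∀ w, w ⬝ᵥ a + (if w = h then 1 else 0) = w ⬝ᵥ a' + (if w = h' then 1 else 0) + c)
    (hor : 3 ≤ k ∨ a = a') : h = h' ∧ a = a' ∧ c = 0 := by
  have hh : h = h' := by
    by_contra hne
    obtain ⟨i, hi⟩ := Function.ne_iff.1 hne
    rcases hor with hk3 | rfl
    · obtain ⟨j, hj⟩ : ∃ j : Fin k, j ≠ i :=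
        Fintype.exists_ne_of_one_lt_card (by rw [Fintype.card_fin]; omega) i
      obtain ⟨l, hl⟩ : ∃ l : Fin k, l ∉ ({i, j} : Finset (Fin k)) := by
        by_contra! hall
        have := Finset.card_le_card (fun x _ => hall x : (Finset.univ : Finset (Fin k)) ⊆ _)
        have h2 := Finset.card_le_two (a := i) (b := j)
        rw [Finset.card_univ, Fintype.card_fin] at this
        omega
      simp only [Finset.mem_insert, Finset.mem_singleton, not_or] at hl
      set u : F2Vec k := Pi.single j 1 with hu
      set v : F2Vec k := Pi.single l 1 with hv
      have ui : u i = 0 := by simp [hu, hj.symm]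
      have vi : v i = 0 := by simp [hv, Ne.symm hl.1]
      have uj : u j = 1 := by simp [hu]
      have vj : v j = 0 := by simp [hv, Ne.symm hl.2]
      have vl : v l = 1 := by simp [hv]
      have e0 : h ≠ h' := hne
      have e1 : h + u ≠ h' := fun e => hi (by rw [← e]; simp [ui])
      have e2 : h + v ≠ h' := fun e => hi (by rw [← e]; simp [vi])
      have e3 : h + u + v ≠ h' := fun e => hi (by rw [← e]; simp [ui, vi])
      have f1 : h + u ≠ h := fun e => by
        simpa [uj] using congr_fun e j
      have f2 : h + v ≠ h := fun e => by
        simpa [vl] using congr_fun e l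
      have f3 : h + u + v ≠ h := fun e => by
        simpa [uj, vj] using congr_fun e j
      have g0 := H h
      have g1 := H (h + u)
      have g2 := H (h + v)
      have g3 := H (h + u + v)
      rw [if_pos rfl, if_neg e0] at g0
      rw [if_neg e1, if_neg f1] at g1
      rw [if_neg e2, if_neg f2] at g2
      rw [if_neg e3, if_neg f3] at g3
      have q := quad_affine a h u v 0
      have q' := quad_affine a' h u v c
      have : (1 : ZMod 2) = 0 := by linear_combination g0 + g1 + g2 + g3 - q + q'
      exact one_ne_zero this
    · obtain ⟨j, hj⟩ : ∃ j : Fin k, j ≠ i :=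
        Fintype.exists_ne_of_one_lt_card (by rw [Fintype.card_fin]; omega) i
      set u : F2Vec k := Pi.single j 1 with hu
      have ui : u i = 0 := by simp [hu, hj.symm]
      have uj : u j = 1 := by simp [hu]
      have e1 : h + u ≠ h' := fun e => hi (by rw [← e]; simp [ui])
      have f1 : h + u ≠ h := fun e => by simpa [uj] using congr_fun e j
      have g0 := H h
      have g1 := H (h + u)
      rw [if_pos rfl, if_neg hne] at g0
      rw [if_neg e1, if_neg f1] at g1
      have : (1 : ZMod 2) = 0 := by linear_combination g0 - g1
      exact one_ne_zero this
  subst hh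
  -- At `w = 0` both linear parts vanish, and the indicators now coincide.
  have hc : c = 0 := by simpa using H 0
  refine ⟨rfl, dotProduct_eq _ _ fun w => ?_, hc⟩
  rw [dotProduct_comm a, dotProduct_comm a']
  have := H w
  rw [hc] at this
  linear_combination this

theorem eq_of_mmFun_slice_eq {π π' : Equiv.Perm (F2Vec n)} {φ φ' : F2Vec n → ZMod 2}
    {y : F2Vec n} (h : ∀ x, mmFun π φ (x, y) = mmFun π' φ' (x, y)) :
    π y = π' y ∧ φ y = φ' y := by
  have h0 : φ y = φ' y := by simpa [mmFun] using h 0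
  refine ⟨dotProduct_eq _ _ fun w => ?_, h0⟩
  have := h w
  simp only [mmFun, h0] at this
  rw [dotProduct_comm _ w, dotProduct_comm _ w]
  linear_combination this

theorem mmFun_injective {π π' : Equiv.Perm (F2Vec n)} {φ φ' : F2Vec n → ZMod 2}
    (h : mmFun π φ = mmFun π' φ') : π = π' ∧ φ = φ' :=
  ⟨Equiv.ext fun _ => (eq_of_mmFun_slice_eq fun x => congr_fun h (x, _)).1,
    funext fun _ => (eq_of_mmFun_slice_eq fun x => congr_fun h (x, _)).2⟩

theorem slice_frame {L M : AffSub (F2Vec n) k} (h : F2Vec k →ᵃ[ZMod 2] F2Vec k)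
    {π : Equiv.Perm (F2Vec n)} {φ : F2Vec n → ZMod 2} {t w : F2Vec k}
    (hπ : π (frame L t) = frame M w) (x : F2Vec n) :
    (mmFun π φ + charFun (frameSet L M h)) (x, frame L t) =
      tr (frame M).linear x ⬝ᵥ w + (if tr (frame M).linear x = h t then 1 else 0) +
        (x ⬝ᵥ frame M 0 + φ (frame L t)) := by
  classical
  rw [Pi.add_apply, charFun_eq_ite, if_congr mem_frameSet rfl rfl]
  simp only [mmFun]
  rw [hπ, dot_frame]
  ring

theorem Datum.fn_injective (hk : 2 ≤ k) {B : Set (Equiv.Perm (F2Vec k))}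
    (hB : 3 ≤ k ∨ B.Subsingleton) : Function.Injective (Datum.fn : Datum n k B → _) := by
  rintro ⟨⟨⟨L, M⟩, ⟨α, hα⟩, h, G⟩, ⟨π, hπ⟩, φ, hφ⟩
    ⟨⟨⟨L', M'⟩, ⟨α', hα'⟩, h', G'⟩, ⟨π', hπ'⟩, φ', hφ'⟩ e
  simp only [Datum.fn] at e hπ hπ' hφ hφ'
  have hL : L = L' := by
    apply Subtype.ext
    ext y
    rw [← not_sliceAffine_iff hk L M h π φ y, ← not_sliceAffine_iff hk L' M' h' π' φ' y, e]
  subst hL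
  have hout : ∀ y, y ∉ L.1 → π y = π' y ∧ φ y = φ' y := by
    intro y hy
    refine eq_of_mmFun_slice_eq fun x => ?_
    have := congr_fun e (x, y)
    simpa [charFun_of_notMem fun hm => hy (mem_of_mem_frameSet (M := M) (h := h) (x := x) hm),
      charFun_of_notMem fun hm => hy (mem_of_mem_frameSet (M := M') (h := h') (x := x) hm)]
      using this
  have key : ∀ {N : AffSub (F2Vec n) k} {β : Equiv.Perm (F2Vec k)} {σ : Equiv.Perm (F2Vec n)},
      (∀ t, σ (frame L t) = frame N (β t)) → ∀ z, z ∈ N.1 ↔ σ.symm z ∈ L.1 := by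
    intro N β σ hσ z
    rw [← SetLike.mem_coe, ← SetLike.mem_coe, ← range_frame, ← range_frame]
    constructor
    · rintro ⟨t, rfl⟩
      refine ⟨β.symm t, ?_⟩
      rw [Equiv.eq_symm_apply, hσ, Equiv.apply_symm_apply]
    · rintro ⟨t, ht⟩
      refine ⟨β t, ?_⟩
      rw [← hσ, ht, Equiv.apply_symm_apply]
  -- `M` and `M'` are the images of `L`; their complements coincide because the permutations agree
  -- off `L`.
  have hM : M = M' := by
    apply Subtype.ext
    ext z
    rw [key hπ, key hπ', not_iff_not.symm]
    constructor
    · intro hz hz'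
      have := (hout _ hz).1
      rw [Equiv.apply_symm_apply] at this
      apply hz
      rw [this, Equiv.symm_apply_apply] at hz'
      exact hz'
    · intro hz hz'
      have := (hout _ hz).1
      rw [Equiv.apply_symm_apply] at this
      apply hz
      rw [← this, Equiv.symm_apply_apply] at hz'
      exact hz'
  subst hM
  have hin : ∀ t, h t = h' t ∧ α t = α' t ∧ φ (frame L t) = φ' (frame L t) := by
    intro t
    have H : h t = h' t ∧ α t = α' t ∧ φ (frame L t) + φ' (frame L t) = 0 := by
      refine eq_of_indicator_add_linear hk (fun w => ?_) (hB.imp_right fun hs => by rw [hs hα hα'])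
      obtain ⟨x, rfl⟩ := tr_surjective (frame_linear_injective M) w
      have := congr_fun e (x, frame L t)
      rw [slice_frame h (hπ t), slice_frame h' (hπ' t)] at this
      have q := add_self_zmod_two (φ (frame L t))
      linear_combination this - q
    exact ⟨H.1, H.2.1, add_eq_zero_iff_zmod_two.1 H.2.2⟩
  obtain rfl : h = h' := AffineMap.ext fun t => (hin t).1
  obtain rfl : α = α' := Equiv.ext fun t => (hin t).2.1
  obtain rfl : G = G' := by
    refine AffineMap.ext fun t => ?_
    have := (hin t).2.2
    rw [hφ, hφ'] at this
    exact add_right_cancel this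
  obtain rfl : φ = φ' := by
    funext y
    by_cases hy : y ∈ L.1
    · rw [← SetLike.mem_coe, ← range_frame] at hy
      obtain ⟨t, rfl⟩ := hy
      exact (hin t).2.2
    · exact (hout y hy).2
  obtain rfl : π = π' := by
    refine Equiv.ext fun y => ?_
    by_cases hy : y ∈ L.1
    · rw [← SetLike.mem_coe, ← range_frame] at hy
      obtain ⟨t, rfl⟩ := hy
      rw [hπ, hπ']
    · exact (hout y hy).1
  rfl

end Slices

/-! ### Counting affine subspaces, extensions and data. -/

section Counting

variable {n k : ℕ}

theorem natCard_affineMap (k m : ℕ) :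
    Nat.card (F2Vec k →ᵃ[ZMod 2] F2Vec m) = 2 ^ ((k + 1) * m) := by
  rw [Module.natCard_eq_pow_finrank (K := ZMod 2), AffineMap.finrank_eq, finrank_fin_fun,
    finrank_fin_fun, Nat.card_zmod]

theorem natCard_affineFun (k : ℕ) :
    Nat.card (F2Vec k →ᵃ[ZMod 2] ZMod 2) = 2 ^ (k + 1) := by
  rw [Module.natCard_eq_pow_finrank (K := ZMod 2), AffineMap.finrank_eq, finrank_fin_fun,
    finrank_self, Nat.card_zmod, mul_one]

instance : Finite (F2Vec n →ᵃ[ZMod 2] F2Vec k) :=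
  Nat.finite_of_card_ne_zero (by rw [natCard_affineMap]; positivity)

instance : Finite (F2Vec n →ᵃ[ZMod 2] ZMod 2) :=
  Nat.finite_of_card_ne_zero (by rw [natCard_affineFun]; positivity)

theorem natCard_notMem_range {X Y : Type*} [Finite X] [Finite Y] {e : X → Y}
    (he : Function.Injective e) :
    Nat.card {y // y ∉ Set.range e} = Nat.card Y - Nat.card X := by
  have h := Set.ncard_add_ncard_compl (Set.range e)
  have h1 : (Set.range e).ncard = Nat.card X := by
    rw [← Nat.card_coe_set_eq]
    exact Nat.card_congr (Equiv.ofInjective e he).symm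
  have h2 : Nat.card {y // y ∉ Set.range e} = ((Set.range e)ᶜ).ncard := by
    rw [← Nat.card_coe_set_eq]
    rfl
  omega

theorem natCard_perm_extending {X Y : Type*} [Finite X] [Finite Y] {e m : X → Y}
    (he : Function.Injective e) (hm : Function.Injective m) :
    Nat.card {π : Equiv.Perm Y // ∀ t, π (e t) = m t} =
      (Nat.card Y - Nat.card X).factorial := by
  classical
  -- Multiplying by the inverse of one fixed extension leaves the permutations that fix `range e`
  -- pointwise.
  obtain ⟨π₀, h₀⟩ := Equiv.Perm.exists_extending_pair e m he hm
  have h1 : {π : Equiv.Perm Y // ∀ t, π (e t) = m t} ≃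
      {σ : Equiv.Perm Y // ∀ y, ¬ (y ∉ Set.range e) → σ y = y} :=
    (Equiv.mulLeft π₀⁻¹).subtypeEquiv fun π => by
      simp only [not_not, Set.forall_mem_range, Equiv.coe_mulLeft, Equiv.Perm.coe_mul,
        Function.comp_apply, Equiv.Perm.inv_eq_iff_eq]
      exact forall_congr' fun t => by rw [h₀]
  rw [Nat.card_congr (h1.trans (Equiv.Perm.subtypeEquivSubtypePerm _).symm), Nat.card_perm,
    natCard_notMem_range he]

theorem natCard_fun_extending {X Y Z : Type*} [Finite X] [Finite Y] {e : X → Y}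
    (he : Function.Injective e) (ψ : X → Z) :
    Nat.card {φ : Y → Z // ∀ t, φ (e t) = ψ t} = Nat.card Z ^ (Nat.card Y - Nat.card X) := by
  classical
  have h1 : {φ : Y → Z // ∀ t, φ (e t) = ψ t} ≃
      {φ : Y → Z // φ ∘ ((↑) : {y // y ∈ Set.range e} → Y) =
        fun y => ψ ((Equiv.ofInjective e he).symm y)} :=
    Equiv.subtypeEquivRight fun φ => by
      constructor
      · rintro h
        funext ⟨_, t, rfl⟩
        rw [Function.comp_apply, h]
        exact congr_arg ψ ((Equiv.symm_apply_eq _).2 rfl).symm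
      · intro h t
        refine (congr_fun h ⟨e t, t, rfl⟩).trans ?_
        exact congr_arg ψ ((Equiv.symm_apply_eq _).2 rfl)
  rw [Nat.card_congr (h1.trans (Equiv.subtypePreimage _ _)), Nat.card_fun,
    natCard_notMem_range he]

theorem natCard_sigma_const {X : Type*} [Finite X] {Y : X → Type*} [∀ x, Finite (Y x)] {c : ℕ}
    (h : ∀ x, Nat.card (Y x) = c) : Nat.card (Σ x, Y x) = Nat.card X * c := by
  have := Fintype.ofFinite X
  rw [Nat.card_sigma, Finset.sum_congr rfl fun x _ => h x, Finset.sum_const, Finset.card_univ,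
    Nat.card_eq_fintype_card, smul_eq_mul]

theorem natCard_datum (n k : ℕ) (B : Set (Equiv.Perm (F2Vec k))) :
    Nat.card (Datum n k B) = (Nat.card (AffSub (F2Vec n) k) * Nat.card (AffSub (F2Vec n) k) *
      (B.ncard * (2 ^ ((k + 1) * k) * 2 ^ (k + 1)))) *
        ((2 ^ n - 2 ^ k).factorial * 2 ^ (2 ^ n - 2 ^ k)) := by
  have hv : ∀ m, Nat.card (F2Vec m) = 2 ^ m := fun m => by simp
  unfold Datum
  rw [natCard_sigma_const (c := (2 ^ n - 2 ^ k).factorial * 2 ^ (2 ^ n - 2 ^ k))]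
  · simp only [Nat.card_prod, natCard_affineMap, natCard_affineFun, Nat.card_coe_set_eq]
  · rintro ⟨⟨L, M⟩, α, h, G⟩
    rw [Nat.card_prod, natCard_perm_extending (e := frame L) (m := fun t => frame M (α.1 t))
      (frame_injective L) ((frame_injective M).comp α.1.injective),
      natCard_fun_extending (frame_injective L) fun t => G t + h t ⬝ᵥ α.1 t, hv, hv, Nat.card_zmod]

/-- An affine map is its value at 0 with its linear part; an injective linear part is a linearly
independent `k`-tuple. -/
theorem natCard_injective_affineMap (hk : k ≤ n) :
    Nat.card {e : F2Vec k →ᵃ[ZMod 2] F2Vec n // Function.Injective e} =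
      2 ^ n * ∏ i : Fin k, (2 ^ n - 2 ^ (i : ℕ)) := by
  have h := card_linearIndependent (K := ZMod 2) (V := F2Vec n) (k := k)
    (by rwa [finrank_fin_fun])
  rw [finrank_fin_fun, ZMod.card] at h
  have e1 : {e : F2Vec k →ᵃ[ZMod 2] F2Vec n // Function.Injective e} ≃
      {p : F2Vec n × (F2Vec k →ₗ[ZMod 2] F2Vec n) // Function.Injective p.2} :=
    (AffineMap.toConstProdLinearMap (ZMod 2)).toEquiv.subtypeEquiv fun e =>
      e.linear_injective_iff.symm
  have e2 : {s : Fin k → F2Vec n // LinearIndependent (ZMod 2) s} ≃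
      {ρ : F2Vec k →ₗ[ZMod 2] F2Vec n // Function.Injective ρ} :=
    ((Pi.basisFun (ZMod 2) (Fin k)).constr (ZMod 2)).toEquiv.subtypeEquiv fun s => by
      rw [linearIndependent_iff_injective_fintypeLinearCombination]
      have : (Pi.basisFun (ZMod 2) (Fin k)).constr (ZMod 2) s =
          Fintype.linearCombination (ZMod 2) s := by
        refine LinearMap.ext fun w => ?_
        simp [Module.Basis.constr_apply_fintype, Fintype.linearCombination_apply]
      rw [LinearEquiv.coe_toEquiv, this]
  have e3 : {p : F2Vec n × (F2Vec k →ₗ[ZMod 2] F2Vec n) // Function.Injective p.2} ≃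
      F2Vec n × {ρ : F2Vec k →ₗ[ZMod 2] F2Vec n // Function.Injective ρ} :=
    { toFun := fun p => (p.1.1, ⟨p.1.2, p.2⟩)
      invFun := fun p => ⟨(p.1, p.2.1), p.2.2⟩
      left_inv := fun _ => rfl
      right_inv := fun _ => rfl }
  rw [Nat.card_congr (e1.trans e3), Nat.card_prod, ← Nat.card_congr e2, h]
  simp

/-- An injective affine map factors uniquely as an affine automorphism of `F2Vec k` followed by the
frame of its image. -/
theorem natCard_affSub_mul :
    Nat.card {e : F2Vec k →ᵃ[ZMod 2] F2Vec n // Function.Injective e} =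
      Nat.card (AffSub (F2Vec n) k) *
        Nat.card {u : F2Vec k →ᵃ[ZMod 2] F2Vec k // Function.Injective u} := by
  rw [← Nat.card_prod]
  refine (Nat.card_congr (Equiv.ofBijective
    (fun p : AffSub (F2Vec n) k × {u : F2Vec k →ᵃ[ZMod 2] F2Vec k // Function.Injective u} =>
      (⟨(frame p.1).comp p.2.1, (frame_injective p.1).comp p.2.2⟩ :
        {e : F2Vec k →ᵃ[ZMod 2] F2Vec n // Function.Injective e})) ⟨?_, ?_⟩)).symm
  · rintro ⟨L, u, hu⟩ ⟨L', u', hu'⟩ h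
    have h' : ∀ t, frame L (u t) = frame L' (u' t) :=
      fun t => DFunLike.congr_fun (congr_arg Subtype.val h) t
    have hr : ∀ (N : AffSub (F2Vec n) k) (v : F2Vec k →ᵃ[ZMod 2] F2Vec k),
        Function.Injective v → (N.1 : Set (F2Vec n)) = Set.range fun t => frame N (v t) := by
      intro N v hv
      exact (range_frame N).symm.trans
        ((Finite.surjective_of_injective hv).range_comp (frame N)).symm
    obtain rfl : L = L' := by
      apply Subtype.ext
      apply SetLike.coe_injective
      rw [hr L u hu, hr L' u' hu']
      exact congr_arg Set.range (funext h')
    obtain rfl : u = u' := AffineMap.ext fun t => frame_injective L (h' t)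
    rfl
  · rintro ⟨e, he⟩
    obtain ⟨U, hU, hr⟩ := affSub_of_range he (k := k) (finrank_fin_fun _)
    obtain ⟨g, hg⟩ := exists_affine_leftInverse (frame_injective ⟨U, hU⟩)
    have hge : ∀ t, frame ⟨U, hU⟩ (g (e t)) = e t := by
      intro t
      have : e t ∈ Set.range (frame ⟨U, hU⟩) := by
        rw [range_frame, hr]
        exact ⟨t, rfl⟩
      obtain ⟨s, hs⟩ := this
      rw [← hs, hg]
    refine ⟨⟨⟨U, hU⟩, g.comp e, fun s t hst => he ?_⟩, ?_⟩
    · rw [← hge s, ← hge t]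
      exact congr_arg _ hst
    · apply Subtype.ext
      exact AffineMap.ext hge

theorem cast_natCard_affSub (hk : k ≤ n) :
    (Nat.card (AffSub (F2Vec n) k) : ℚ) = 2 ^ (n - k) * gaussBinom n k := by
  have h := natCard_affSub_mul (n := n) (k := k)
  have hc : ∀ m, k ≤ m → ((∏ i : Fin k, (2 ^ m - 2 ^ (i : ℕ)) : ℕ) : ℚ) =
      ∏ i ∈ Finset.range k, ((2 : ℚ) ^ m - 2 ^ i) := by
    intro m hm
    rw [← Fin.prod_univ_eq_prod_range (fun i => (2 : ℚ) ^ m - 2 ^ i), Nat.cast_prod]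
    refine Finset.prod_congr rfl fun i _ => ?_
    rw [Nat.cast_sub (Nat.pow_le_pow_right (by norm_num) (by omega))]
    push_cast
    rfl
  rw [natCard_injective_affineMap hk, natCard_injective_affineMap le_rfl] at h
  have h' := congr_arg (Nat.cast : ℕ → ℚ) h
  rw [Nat.cast_mul, Nat.cast_mul, Nat.cast_mul, hc n hk, hc k le_rfl] at h'
  have hpos : (∏ i ∈ Finset.range k, ((2 : ℚ) ^ k - 2 ^ i)) ≠ 0 := by
    refine Finset.prod_ne_zero_iff.2 fun i hi => ?_
    have : (2 : ℚ) ^ i < 2 ^ k := pow_lt_pow_right₀ (by norm_num) (Finset.mem_range.1 hi)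
    linarith
  rw [gaussBinom, Finset.prod_div_distrib]
  have h2 : (2 : ℚ) ^ n = 2 ^ (n - k) * 2 ^ k := by rw [← pow_add]; congr 1; omega
  push_cast at h'
  rw [← mul_div_assoc, eq_div_iff hpos]
  have hk2 : (2 : ℚ) ^ k ≠ 0 := by positivity
  apply mul_left_cancel₀ hk2
  set P := ∏ i ∈ Finset.range k, ((2 : ℚ) ^ n - 2 ^ i)
  linear_combination -h' + P * h2

theorem ncard_MM (n : ℕ) : (MM n).ncard = (2 ^ n).factorial * 2 ^ 2 ^ n := by
  have h : MM n = Set.range fun p : Equiv.Perm (F2Vec n) × (F2Vec n → ZMod 2) =>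
      mmFun p.1 p.2 := by
    ext f
    simp [MM, eq_comm]
  rw [h, ← Nat.card_coe_set_eq, ← Nat.card_congr (Equiv.ofInjective _ _), Nat.card_prod,
    Nat.card_perm, Nat.card_fun]
  · simp
  · intro p q hpq
    exact Prod.ext_iff.2 (mmFun_injective hpq)

theorem cast_natCard_datum (hk : k ≤ n) (B : Set (Equiv.Perm (F2Vec k))) :
    (Nat.card (Datum n k B) : ℚ) = rho n k * (B.ncard / (2 ^ k).factorial) *
      (2 : ℚ) ^ (((k : ℤ) + 1) ^ 2 - (2 : ℤ) ^ k) * (MM n).ncard := by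
  rw [natCard_datum, ncard_MM, rho]
  push_cast
  rw [cast_natCard_affSub hk]
  -- The exponent is an integer because it is negative from `k = 6` on.
  have h1 : (2 : ℚ) ^ (((k : ℤ) + 1) ^ 2 - (2 : ℤ) ^ k) = 2 ^ ((k + 1) ^ 2) / 2 ^ 2 ^ k := by
    rw [zpow_sub₀ (by norm_num)]
    norm_cast
  have h2 : (2 : ℚ) ^ 2 ^ n = 2 ^ (2 ^ n - 2 ^ k) * 2 ^ 2 ^ k := by
    rw [← pow_add]
    congr 1
    have := Nat.pow_le_pow_right (n := 2) (by norm_num) hk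
    omega
  have h3 : (2 : ℚ) ^ ((k + 1) ^ 2) = 2 ^ ((k + 1) * k) * 2 ^ (k + 1) := by
    rw [← pow_add]
    ring_nf
  have h4 : ((2 ^ k).factorial : ℚ) ≠ 0 := by positivity
  have h5 : ((2 ^ n).factorial : ℚ) ≠ 0 := by positivity
  have h6 : (2 : ℚ) ^ 2 ^ k ≠ 0 := by positivity
  rw [h1, h2, h3, two_mul, pow_add]
  field_simp
  ring

end Counting

/-! ### Data yield functions of the construction; dimensions 0 and 1 stay in the class. -/

section Structure

variable {n k : ℕ}

theorem mmFun_of_mem_slice {L M : AffSub (F2Vec n) k} {h : F2Vec k →ᵃ[ZMod 2] F2Vec k}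
    {π : Equiv.Perm (F2Vec n)} {φ : F2Vec n → ZMod 2} {t w : F2Vec k} {x : F2Vec n}
    (hπ : π (frame L t) = frame M w) (hx : tr (frame M).linear x = h t) :
    mmFun π φ (x, frame L t) = h t ⬝ᵥ w + φ (frame L t) + x ⬝ᵥ frame M 0 := by
  simp only [mmFun]
  rw [hπ, dot_frame, hx]
  ring

theorem nearFrame_subset_spClass (B : Set (Equiv.Perm (F2Vec k))) :
    nearFrame n k B ⊆ spClass (MM n) := by
  intro g hg
  rw [mem_nearFrame] at hg
  obtain ⟨L, M, α, -, h, G, π, φ, hπ, hφ, rfl⟩ := hg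
  have hM := frame_linear_injective M
  set ρ := (frame M).linear
  obtain ⟨s, hs⟩ := (tr ρ).exists_rightInverse_of_surjective
    (LinearMap.range_eq_top.2 (tr_surjective hM))
  have hs' : ∀ c, tr ρ (s c) = c := LinearMap.congr_fun hs
  -- The section `s` chooses a base point in each fibre and the kernel of `tr ρ` is the fibre
  -- direction, so the dimension is `k + (n - k)`.
  let ψ₁ : F2Vec k × LinearMap.ker (tr ρ) →ᵃ[ZMod 2] F2Vec n :=
    s.toAffineMap.comp (h.comp (LinearMap.fst _ _ _).toAffineMap) +
      ((LinearMap.ker (tr ρ)).subtype ∘ₗ LinearMap.snd _ _ _).toAffineMap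
  let ψ := ψ₁.prod
    ((frame L).comp (LinearMap.fst (ZMod 2) (F2Vec k) (LinearMap.ker (tr ρ))).toAffineMap)
  have hψ : ∀ q, ψ q = (s (h q.1) + q.2, frame L q.1) := fun q => rfl
  have inj : Function.Injective ψ := by
    rintro ⟨t, z⟩ ⟨t', z'⟩ e
    rw [hψ, hψ, Prod.mk.injEq] at e
    obtain rfl := frame_injective L e.2
    exact Prod.ext rfl (Subtype.ext (add_left_cancel e.1))
  obtain ⟨U, hU, hr⟩ := affSub_of_range inj (k := n) (by
    rw [finrank_prod, finrank_fin_fun, add_comm, finrank_ker_tr hM])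
  have hS : (U : Set (F2Vec n × F2Vec n)) = frameSet L M h := by
    rw [hr]
    ext ⟨x, y⟩
    constructor
    · rintro ⟨q, hq⟩
      rw [hψ, Prod.mk.injEq] at hq
      obtain ⟨rfl, rfl⟩ := hq
      rw [mem_frameSet, map_add, hs', LinearMap.mem_ker.1 q.2.2, add_zero]
    · rintro ⟨t, rfl, hx⟩
      refine ⟨(t, ⟨x - s (h t), ?_⟩), ?_⟩
      · rw [LinearMap.mem_ker, map_sub, hs', ← hx, sub_self]
      · simp [hψ]
  refine Set.mem_biUnion ⟨π, φ, rfl⟩ ⟨U, hU, ?_, by rw [hS]⟩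
  rw [affineOn_iff_of_range inj hr.symm]
  -- On the subspace the term `h t ⬝ᵥ α t` occurs twice and cancels, which leaves `G t + x ⬝ᵥ frame
  -- M 0`.
  let d : F2Vec n →ₗ[ZMod 2] ZMod 2 := (dotProductBilin (ZMod 2) (ZMod 2)).flip (frame M 0)
  refine ⟨G.comp (LinearMap.fst _ _ _).toAffineMap + d.toAffineMap.comp ψ₁, fun q => ?_⟩
  rw [hψ, mmFun_of_mem_slice (hπ q.1)
    (show _ = h q.1 by rw [map_add, hs', LinearMap.mem_ker.1 q.2.2, add_zero]), hφ]
  have := add_self_zmod_two (h q.1 ⬝ᵥ α q.1)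
  change _ = G q.1 + (s (h q.1) + q.2.1) ⬝ᵥ frame M 0
  linear_combination this

/-- Adding the indicator of the subspace `y = 0` only flips `φ` at 0, so every function of the class
arises from another one. -/
theorem MM_subset_spClass (n : ℕ) : MM n ⊆ spClass (MM n) := by
  classical
  rintro _ ⟨π, φ, rfl⟩
  have inj : Function.Injective (LinearMap.inl (ZMod 2) (F2Vec n) (F2Vec n)).toAffineMap :=
    LinearMap.inl_injective
  obtain ⟨U, hU, hr⟩ := affSub_of_range inj (finrank_fin_fun (ZMod 2) (n := n))
  have hmem : ∀ x y, (x, y) ∈ (U : Set (F2Vec n × F2Vec n)) ↔ y = 0 := by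
    intro x y
    rw [hr]
    constructor
    · rintro ⟨z, hz⟩
      exact (Prod.ext_iff.1 hz).2.symm
    · rintro rfl
      exact ⟨x, rfl⟩
  refine Set.mem_biUnion ⟨π, φ + Pi.single 0 1, rfl⟩ ⟨U, hU, ?_, ?_⟩
  · rw [affineOn_iff_of_range inj hr.symm]
    let d : F2Vec n →ₗ[ZMod 2] ZMod 2 := (dotProductBilin (ZMod 2) (ZMod 2)).flip (π 0)
    exact ⟨d.toAffineMap + AffineMap.const _ _ (φ 0 + 1), fun x => by simp [mmFun, d]⟩
  · funext ⟨x, y⟩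
    rw [Pi.add_apply, charFun_eq_ite, if_congr (hmem x y) rfl rfl]
    simp only [mmFun, Pi.add_apply, Pi.single_apply]
    rw [← add_assoc, add_assoc, add_self_zmod_two, add_zero]

theorem nearFrame_zero_subset (B : Set (Equiv.Perm (F2Vec 0))) : nearFrame n 0 B ⊆ MM n := by
  classical
  intro g hg
  rw [mem_nearFrame] at hg
  obtain ⟨L, M, α, -, h, G, π, φ, hπ, hφ, rfl⟩ := hg
  refine ⟨π, φ + Pi.single (frame L 0) 1, funext fun ⟨x, y⟩ => ?_⟩
  by_cases hy : y = frame L 0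
  · subst hy
    rw [Pi.add_apply, charFun_of_mem (mem_frameSet.2 (Subsingleton.elim _ _))]
    simp [mmFun, add_assoc]
  · rw [Pi.add_apply, charFun_of_notMem]
    · simp only [mmFun, Pi.add_apply]
      rw [Pi.single_eq_of_ne hy, add_zero, add_zero]
    · rintro ⟨t, ht, -⟩
      exact hy (by rw [Subsingleton.elim 0 t]; exact ht)

theorem frame_one_cases (t : F2Vec 1) : t = 0 ∨ t = 1 := by
  revert t
  decide

theorem perm_one_add_one : ∀ (α : Equiv.Perm (F2Vec 1)) (t : F2Vec 1), α t + 1 = α (t + 1) := by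
  decide

/-- On `F2Vec 1` the indicator of a point is affine with linear part 1. Adding it replaces `α t` by
`α t + 1 = α (t + 1)`, that is, it composes `π` with the swap of the two points of `L`. -/
theorem nearFrame_one_subset (B : Set (Equiv.Perm (F2Vec 1))) : nearFrame n 1 B ⊆ MM n := by
  classical
  intro g hg
  rw [mem_nearFrame] at hg
  obtain ⟨L, M, α, -, h, G, π, φ, hπ, hφ, rfl⟩ := hg
  have hsum : ∀ t : F2Vec 1, π (Equiv.swap (frame L 0) (frame L 1) (frame L t)) =
      frame M (α t + 1) := by
    intro t
    have hα : α t + 1 = α (t + 1) := by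
      exact perm_one_add_one α t
    rw [hα, ← hπ]
    rcases frame_one_cases t with rfl | rfl
    · rw [Equiv.swap_apply_left, zero_add]
    · rw [Equiv.swap_apply_right]
      rfl
  have hdelta : ∀ a b c : F2Vec 1, a ⬝ᵥ b + (if a = c then 1 else 0) =
      a ⬝ᵥ (b + 1) + (c 0 + 1) := by decide
  have hextra : ∃ ψ : F2Vec n → ZMod 2, (∀ t, ψ (frame L t) = h t 0 + 1) ∧
      ∀ y, y ∉ L.1 → ψ y = 0 := by
    refine ⟨Function.extend (frame L) (fun t => h t 0 + 1) 0,
      fun t => (frame_injective L).extend_apply _ _ t, fun y hy => ?_⟩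
    exact Function.extend_apply' _ _ _ fun ht => hy (by rwa [← SetLike.mem_coe, ← range_frame])
  obtain ⟨ψ, hψ, hψ'⟩ := hextra
  refine ⟨(Equiv.swap (frame L 0) (frame L 1)).trans π, φ + ψ, funext fun ⟨x, y⟩ => ?_⟩
  by_cases hy : y ∈ L.1
  · rw [← SetLike.mem_coe, ← range_frame] at hy
    obtain ⟨t, rfl⟩ := hy
    rw [slice_frame h (hπ t), hdelta]
    simp only [mmFun, Equiv.trans_apply, Pi.add_apply]
    rw [hsum, hψ, dot_frame M x (α t + 1)]
    ring
  · rw [Pi.add_apply, charFun_of_notMem fun hm => hy (mem_of_mem_frameSet hm), add_zero]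
    simp only [mmFun, Equiv.trans_apply, Pi.add_apply]
    rw [hψ' y hy, add_zero, Equiv.swap_apply_of_ne_of_ne]
    · rintro rfl
      exact hy (frame_mem L 0)
    · rintro rfl
      exact hy (frame_mem L 1)

end Structure

/-! ### Every `f ⊕ 1_U` comes from a datum. -/

section Converse

variable {n k : ℕ}

theorem exists_perm_frame {L M : AffSub (F2Vec n) k} {π : Equiv.Perm (F2Vec n)}
    (h : ∀ t, π (frame L t) ∈ M.1) :
    ∃ α : Equiv.Perm (F2Vec k), ∀ t, π (frame L t) = frame M (α t) := by
  have h' : ∀ t, ∃ s, frame M s = π (frame L t) := by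
    intro t
    have := h t
    rwa [← SetLike.mem_coe, ← range_frame] at this
  choose α hα using h'
  have inj : Function.Injective α := fun s t e =>
    frame_injective L (π.injective (by rw [← hα, ← hα, e]))
  exact ⟨Equiv.ofBijective α (Finite.injective_iff_bijective.1 inj), fun t => (hα t).symm⟩

/-- The fibre direction and the projection of a subspace of the product. -/
theorem finrank_comap_inl_add (D : Submodule (ZMod 2) (F2Vec n × F2Vec n)) :
    finrank (ZMod 2) (D.comap (LinearMap.inl (ZMod 2) (F2Vec n) (F2Vec n))) +
      finrank (ZMod 2) (D.map (LinearMap.snd (ZMod 2) (F2Vec n) (F2Vec n))) =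
        finrank (ZMod 2) D := by
  let q : D →ₗ[ZMod 2] F2Vec n := LinearMap.snd _ _ _ ∘ₗ D.subtype
  let j : D.comap (LinearMap.inl (ZMod 2) (F2Vec n) (F2Vec n)) →ₗ[ZMod 2] D :=
    (LinearMap.inl _ _ _ ∘ₗ Submodule.subtype _).codRestrict D fun z => z.2
  have hj : Function.Injective j := fun z z' e =>
    Subtype.ext (Prod.ext_iff.1 (congr_arg Subtype.val e)).1
  have hker : LinearMap.range j = LinearMap.ker q := by
    ext ⟨⟨x, y⟩, hxy⟩
    constructor
    · rintro ⟨z, hz⟩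
      exact (Prod.ext_iff.1 (congr_arg Subtype.val hz)).2.symm
    · intro h
      obtain rfl : y = 0 := h
      exact ⟨⟨x, hxy⟩, rfl⟩
  have hrange : LinearMap.range q = D.map (LinearMap.snd (ZMod 2) (F2Vec n) (F2Vec n)) := by
    rw [LinearMap.range_comp, Submodule.range_subtype]
  rw [← LinearMap.finrank_range_of_inj hj, hker, ← hrange, add_comm,
    LinearMap.finrank_range_add_finrank_ker]

/-- The chosen parametrization of the projection of an affine subspace lifts to it. -/
theorem exists_lift_frame {U : AffineSubspace (ZMod 2) (F2Vec n × F2Vec n)}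
    {L : AffSub (F2Vec n) k}
    (hL : U.map (LinearMap.snd (ZMod 2) (F2Vec n) (F2Vec n)).toAffineMap = L.1) :
    ∃ A : F2Vec k →ᵃ[ZMod 2] F2Vec n × F2Vec n, (∀ t, A t ∈ U) ∧ ∀ t, (A t).2 = frame L t := by
  obtain ⟨p, hp, hp0⟩ : ∃ p ∈ U, p.2 = frame L 0 := by
    have := frame_mem L 0
    rw [← hL, AffineSubspace.mem_map] at this
    exact this
  let q : U.direction →ₗ[ZMod 2] F2Vec n := LinearMap.snd _ _ _ ∘ₗ U.direction.subtype
  have hrange : LinearMap.range q = L.1.direction := by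
    rw [LinearMap.range_comp, Submodule.range_subtype, ← hL, AffineSubspace.map_direction]
    rfl
  obtain ⟨g, hg⟩ := Module.projective_lifting_property q.rangeRestrict
    ((frame L).linear.codRestrict (LinearMap.range q) fun t => by
      rw [hrange, ← range_frame_linear]
      exact ⟨t, rfl⟩) q.surjective_rangeRestrict
  have hg' : ∀ t, (g t).1.2 = (frame L).linear t :=
    fun t => congr_arg Subtype.val (LinearMap.congr_fun hg t)
  refine ⟨(U.direction.subtype ∘ₗ g).toAffineMap + AffineMap.const _ _ p, fun t => ?_, fun t => ?_⟩
  · exact AffineSubspace.vadd_mem_of_mem_direction (g t).2 hp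
  · rw [AffineMap.decomp_zero (frame L) t, ← hg', ← hp0]
    rfl

theorem near_subset (π : Equiv.Perm (F2Vec n)) (φ : F2Vec n → ZMod 2) :
    near (mmFun π φ) ⊆ ⋃ k ∈ Finset.range (n + 1), nearFrame n k Set.univ := by
  rintro _ ⟨U, ⟨hne, hdim⟩, ⟨F, hF⟩, rfl⟩
  set L' := U.map (LinearMap.snd (ZMod 2) (F2Vec n) (F2Vec n)).toAffineMap with hL'
  set k := finrank (ZMod 2) L'.direction with hk
  let L : AffSub (F2Vec n) k := ⟨L', hne.image _, rfl⟩
  set R := U.direction.comap (LinearMap.inl (ZMod 2) (F2Vec n) (F2Vec n)) with hR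
  have hRk : finrank (ZMod 2) R + k = n := by
    have := finrank_comap_inl_add U.direction
    rw [hdim] at this
    rw [hk, hL', AffineSubspace.map_direction]
    exact this
  obtain ⟨A, hAU, hA⟩ := exists_lift_frame (L := L) hL'.symm
  have hR_iff : ∀ t x, (x, frame L t) ∈ U ↔ x - (A t).1 ∈ R := by
    intro t x
    have h1 : (x, frame L t) -ᵥ A t = LinearMap.inl (ZMod 2) (F2Vec n) (F2Vec n) (x - (A t).1) := by
      rw [← hA]
      simp [Prod.ext_iff]
    rw [hR, Submodule.mem_comap, ← h1, AffineSubspace.vsub_right_mem_direction_iff_mem (hAU t)]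
  -- Moving by `(z, 0)` inside `U` changes `f` by `⟨z, π(y)⟩`, while an affine map changes by an
  -- amount independent of `y`.
  have hlin : ∀ z ∈ R, ∀ t, z ⬝ᵥ π (frame L t) = F.linear (z, 0) := by
    intro z hz t
    have h1 : A t = ((A t).1, frame L t) := by rw [← hA]
    have h2 : (z, (0 : F2Vec n)) +ᵥ A t = ((A t).1 + z, frame L t) := by
      rw [h1]
      simp [add_comm]
    have h3 : ((A t).1 + z, frame L t) ∈ U := by
      rw [hR_iff]
      simpa using hz
    have h4 := F.map_vadd (A t) (z, 0)
    rw [h2, ← hF h3, ← hF (hAU t), h1] at h4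
    simp only [mmFun, add_dotProduct, vadd_eq_add] at h4
    linear_combination h4
  let R₀ : AffSub (F2Vec n) (finrank (ZMod 2) R) := ⟨R.toAffineSubspace, ⟨0, R.zero_mem⟩, by
    rw [Submodule.toAffineSubspace_direction]⟩
  have hR₀ : LinearMap.range (frame R₀).linear = R := by
    rw [range_frame_linear]
    exact Submodule.toAffineSubspace_direction R
  -- `T` is `R^⊥`, of dimension `k`.
  set T := LinearMap.ker (tr (frame R₀).linear) with hT
  have hTk : finrank (ZMod 2) T = k := by
    have := finrank_ker_tr (frame_linear_injective R₀)
    rw [← hT] at this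
    omega
  let M : AffSub (F2Vec n) k := ⟨AffineSubspace.mk' (π (frame L 0)) T,
    ⟨_, AffineSubspace.self_mem_mk' _ _⟩, by rw [AffineSubspace.direction_mk', hTk]⟩
  have hMdir : LinearMap.range (frame M).linear = T := by
    rw [range_frame_linear]
    exact AffineSubspace.direction_mk' _ _
  obtain ⟨α, hα⟩ := exists_perm_frame (L := L) (M := M) (π := π) fun t => by
    change π (frame L t) ∈ AffineSubspace.mk' (π (frame L 0)) T
    rw [AffineSubspace.mem_mk', hT, LinearMap.mem_ker, tr_eq_zero_iff]
    intro w
    have hw : (frame R₀).linear w ∈ R := hR₀.le ⟨w, rfl⟩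
    rw [vsub_eq_sub, sub_dotProduct, dotProduct_comm, hlin _ hw, dotProduct_comm, hlin _ hw,
      sub_self]
  -- Double orthogonality: `R` lies in `T^⊥` and has the same dimension `n - k`.
  have hker : R = LinearMap.ker (tr (frame M).linear) := by
    apply Submodule.eq_of_le_of_finrank_eq
    · intro z hz
      rw [LinearMap.mem_ker, tr_eq_zero_iff]
      intro w
      have hw : (frame M).linear w ∈ T := by
        rw [← hMdir]
        exact ⟨w, rfl⟩
      obtain ⟨v, rfl⟩ := hR₀.ge hz
      rw [dotProduct_comm]
      exact tr_eq_zero_iff.1 hw v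
    · have := finrank_ker_tr (frame_linear_injective M)
      omega
  have hset : (U : Set (F2Vec n × F2Vec n)) = frameSet L M ((tr (frame M).linear).toAffineMap.comp
      ((LinearMap.fst (ZMod 2) (F2Vec n) (F2Vec n)).toAffineMap.comp A)) := by
    have hmem : ∀ t x, (x, frame L t) ∈ U ↔ tr (frame M).linear x = tr (frame M).linear (A t).1 := by
      intro t x
      rw [hR_iff, hker, LinearMap.mem_ker, map_sub, sub_eq_zero]
    ext ⟨x, y⟩
    constructor
    · intro hxy
      have hy : y ∈ L.1 := ⟨(x, y), hxy, rfl⟩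
      rw [← SetLike.mem_coe, ← range_frame] at hy
      obtain ⟨t, rfl⟩ := hy
      exact ⟨t, rfl, (hmem t x).1 hxy⟩
    · rintro ⟨t, ht, hx⟩
      simp only at ht
      subst ht
      exact (hmem t x).2 hx
  refine Set.mem_biUnion (Finset.mem_coe.2 (Finset.mem_range.2 (show k < n + 1 by omega))) ?_
  rw [mem_nearFrame]
  let d : F2Vec n →ₗ[ZMod 2] ZMod 2 := (dotProductBilin (ZMod 2) (ZMod 2)).flip (frame M 0)
  refine ⟨L, M, α, trivial, _, F.comp A + d.toAffineMap.comp
    ((LinearMap.fst (ZMod 2) (F2Vec n) (F2Vec n)).toAffineMap.comp A), π, φ, hα, fun t => ?_,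
    by rw [hset]⟩
  have h1 : F (A t) = _ := (hF (hAU t)).symm
  have h2 : A t = ((A t).1, frame L t) := by rw [← hA]
  have h3 := mmFun_of_mem_slice (φ := φ) (h := ((tr (frame M).linear).toAffineMap.comp
      ((LinearMap.fst (ZMod 2) (F2Vec n) (F2Vec n)).toAffineMap.comp A))) (hα t)
      (show tr (frame M).linear (A t).1 = _ from rfl)
  rw [← h2, ← h1] at h3
  change _ = F (A t) + (A t).1 ⬝ᵥ frame M 0 + _
  rw [h3]
  have q1 := add_self_zmod_two ((A t).1 ⬝ᵥ frame M 0)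
  generalize hp : ((tr (frame M).linear).toAffineMap.comp
      ((LinearMap.fst (ZMod 2) (F2Vec n) (F2Vec n)).toAffineMap.comp A)) t ⬝ᵥ α t = p
  have q2 := add_self_zmod_two p
  linear_combination -q1 - q2

theorem nearClass_eq (n : ℕ) :
    nearClass (MM n) = ⋃ k ∈ Finset.Icc 2 n, nearFrame n k Set.univ := by
  ext g
  constructor
  · rintro ⟨hg, hMM⟩
    obtain ⟨_, ⟨π, φ, rfl⟩, hg⟩ := Set.mem_iUnion₂.1 hg
    obtain ⟨k, hk, hgk⟩ := Set.mem_iUnion₂.1 (near_subset π φ hg)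
    refine Set.mem_biUnion (Finset.mem_coe.2 (Finset.mem_Icc.2 ⟨?_, ?_⟩)) hgk
    · by_contra! hlt
      interval_cases k
      · exact hMM (nearFrame_zero_subset _ hgk)
      · exact hMM (nearFrame_one_subset _ hgk)
    · have := Finset.mem_range.1 hk
      omega
  · intro hg
    obtain ⟨k, hk, hgk⟩ := Set.mem_iUnion₂.1 hg
    exact ⟨nearFrame_subset_spClass _ hgk, fun hMM =>
      Set.disjoint_left.1 (nearFrame_disjoint_MM (Finset.mem_Icc.1 hk).1 _) hgk hMM⟩

end Converse

/-! ### Dimension two: all bijections reduce to the identity. -/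

section Plane

variable {n : ℕ}

theorem exists_affine_of_sum_eq_zero {W : Type*} [AddCommGroup W] [Module (ZMod 2) W]
    (u : F2Vec 2 → W) (hu : u ![0, 0] + u ![0, 1] + u ![1, 0] + u ![1, 1] = 0) :
    ∃ F : F2Vec 2 →ᵃ[ZMod 2] W, ∀ t, F t = u t := by
  let l : F2Vec 2 →ₗ[ZMod 2] W :=
    (LinearMap.proj 0).smulRight (u ![1, 0] + u ![0, 0]) +
      (LinearMap.proj 1).smulRight (u ![0, 1] + u ![0, 0])
  refine ⟨l.toAffineMap + AffineMap.const _ _ (u ![0, 0]), fun t => ?_⟩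
  have hF : (l.toAffineMap + AffineMap.const (ZMod 2) (F2Vec 2) (u ![0, 0])) t =
      t 0 • (u ![1, 0] + u ![0, 0]) + t 1 • (u ![0, 1] + u ![0, 0]) + u ![0, 0] := rfl
  rw [hF]
  have q := add_self_zmod_two (u ![0, 0])
  have ht : t = ![0, 0] ∨ t = ![0, 1] ∨ t = ![1, 0] ∨ t = ![1, 1] := by
    clear hF
    revert t
    decide
  rcases ht with rfl | rfl | rfl | rfl
  · simp
  · simp [add_assoc, q]
  · simp [add_assoc, q]
  · have h1 := add_eq_zero_iff_zmod_two.1 hu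
    have h2 : u ![1, 0] + u ![0, 0] + (u ![0, 1] + u ![0, 0]) + u ![0, 0] =
      (u ![0, 0] + u ![0, 1] + u ![1, 0]) + (u ![0, 0] + u ![0, 0]) := by abel
    simp [h2, q, h1]

/-- The indicator of `h` is `(w₀ + h₀ + 1)(w₁ + h₁ + 1)`: its quadratic part is independent of `h`,
and its linear coefficients are those of `h + (1, 1)` with coordinates swapped. Replacing `a` by `t`
is thus offset by adding the swapped `a + t` to `h`. -/
theorem quarter_turn_slice : ∀ w a t h : F2Vec 2,
    w ⬝ᵥ a + (if w = h then 1 else 0) =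
      w ⬝ᵥ t + (if w = h + ![a 1 + t 1, a 0 + t 0] then 1 else 0) +
        (1 + (if a = t then 1 else 0) + h ⬝ᵥ (a + t)) := by
  decide

theorem sum_eq_zero_of_nodup : ∀ a b c d : F2Vec 2, [a, b, c, d].Nodup → a + b + c + d = 0 := by
  decide

/-- By `exists_affine_of_sum_eq_zero`, this makes the correction to `G` in `nearFrame_two_eq`
affine. -/
theorem quarter_turn_sum : ∀ a b c d : F2Vec 2, [a, b, c, d].Nodup →
    (1 + (if a = ![0, 0] then 1 else 0) + ![a 1 + 0, a 0 + 0] ⬝ᵥ ![0, 0]) +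
    (1 + (if b = ![0, 1] then 1 else 0) + ![b 1 + 1, b 0 + 0] ⬝ᵥ ![0, 1]) +
    (1 + (if c = ![1, 0] then 1 else 0) + ![c 1 + 0, c 0 + 1] ⬝ᵥ ![1, 0]) +
    (1 + (if d = ![1, 1] then 1 else 0) + ![d 1 + 1, d 0 + 1] ⬝ᵥ ![1, 1]) = (0 : ZMod 2) := by
  decide

theorem nearFrame_two_eq : nearFrame n 2 Set.univ = nearFrame n 2 {1} := by
  classical
  apply Set.Subset.antisymm
  · intro g hg
    rw [mem_nearFrame] at hg ⊢
    obtain ⟨L, M, α, -, h, G, π, φ, hπ, hφ, rfl⟩ := hg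
    have hα : [α ![0, 0], α ![0, 1], α ![1, 0], α ![1, 1]].Nodup :=
      List.Nodup.map (l := [![0, 0], ![0, 1], ![1, 0], ![1, 1]]) α.injective (by decide)
    have hsum := sum_eq_zero_of_nodup _ _ _ _ hα
    have hquad := quarter_turn_sum _ _ _ _ hα
    -- The four values of a permutation of `F2Vec 2` sum to 0, so the displacement of the marked
    -- point is affine in `t`.
    obtain ⟨J, hJ⟩ := exists_affine_of_sum_eq_zero
      (fun t => (![α t 1 + t 1, α t 0 + t 0] : F2Vec 2)) (by
        have h0 := congr_fun hsum 0
        have h1 := congr_fun hsum 1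
        simp only [Pi.add_apply, Pi.zero_apply] at h0 h1
        have two : (2 : ZMod 2) = 0 := rfl
        funext i
        fin_cases i
        · simp
          linear_combination h1 + two
        · simp
          linear_combination h0 + two)
    obtain ⟨Q, hQ⟩ := exists_affine_of_sum_eq_zero
      (fun t => (1 + (if α t = t then 1 else 0) + ![α t 1 + t 1, α t 0 + t 0] ⬝ᵥ t : ZMod 2)) hquad
    -- `σ` undoes `α` on `L` and fixes everything else.
    let σ : Equiv.Perm (F2Vec n) :=
      Equiv.Perm.viaFintypeEmbedding α.symm ⟨frame L, frame_injective L⟩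
    have hσ : ∀ t, σ (frame L t) = frame L (α.symm t) := fun t =>
      Equiv.Perm.viaFintypeEmbedding_apply_image α.symm ⟨frame L, frame_injective L⟩ t
    have hσ' : ∀ y, y ∉ L.1 → σ y = y := fun y hy =>
      Equiv.Perm.viaFintypeEmbedding_apply_notMem_range α.symm ⟨frame L, frame_injective L⟩ fun hm => hy (by
        rwa [← SetLike.mem_coe, ← range_frame])
    have hπσ : ∀ t, (σ.trans π) (frame L t) = frame M t := fun t => by
      rw [Equiv.trans_apply, hσ, hπ, Equiv.apply_symm_apply]
    -- The constant term produced by `quarter_turn_slice`, to be absorbed into `φ` on `L`.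
    let c : F2Vec 2 → ZMod 2 := fun t => 1 + (if α t = t then 1 else 0) + h t ⬝ᵥ (α t + t)
    let ψ : F2Vec n → ZMod 2 := Function.extend (frame L) c 0
    have hψ : ∀ t, ψ (frame L t) = c t := fun t => (frame_injective L).extend_apply _ _ t
    have hψ' : ∀ y, y ∉ L.1 → ψ y = 0 := fun y hy =>
      Function.extend_apply' _ _ _ fun ht => hy (by rwa [← SetLike.mem_coe, ← range_frame])
    refine ⟨L, M, 1, rfl, h + J, G + Q, σ.trans π, φ + ψ, hπσ, fun t => ?_, ?_⟩
    · rw [Pi.add_apply, hφ, hψ, AffineMap.coe_add, AffineMap.coe_add, Pi.add_apply, Pi.add_apply,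
        hQ, hJ, Equiv.Perm.one_apply]
      simp only [c, dotProduct_add, add_dotProduct]
      have q1 := add_self_zmod_two (h t ⬝ᵥ α t)
      have q2 := add_self_zmod_two ((![α t 1 + t 1, α t 0 + t 0] : F2Vec 2) ⬝ᵥ t)
      linear_combination q1 - q2
    · funext ⟨x, y⟩
      by_cases hy : y ∈ L.1
      · rw [← SetLike.mem_coe, ← range_frame] at hy
        obtain ⟨t, rfl⟩ := hy
        rw [slice_frame h (hπ t), slice_frame (h + J) (hπσ t), quarter_turn_slice _ _ t,
          AffineMap.coe_add, Pi.add_apply, hJ, Pi.add_apply, hψ]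
        simp only [c]
        ring
      · rw [Pi.add_apply, Pi.add_apply,
          charFun_of_notMem fun hm => hy (mem_of_mem_frameSet hm),
          charFun_of_notMem fun hm => hy (mem_of_mem_frameSet hm)]
        simp only [mmFun, Equiv.trans_apply, Pi.add_apply]
        rw [hσ' y hy, hψ' y hy, add_zero, add_zero, add_zero]
  · intro g hg
    rw [mem_nearFrame] at hg ⊢
    obtain ⟨L, M, α, -, h⟩ := hg
    exact ⟨L, M, α, trivial, h⟩

end Plane

/-! ### Information sets, and the sum over dimensions. -/

section InfoSet

variable {n k : ℕ}

/-- Extension by zero as a linear map. -/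
def coordsLin (I : Finset (Fin n)) : (I → ZMod 2) →ₗ[ZMod 2] F2Vec n where
  toFun := coords I
  map_add' v w := by
    funext i
    by_cases h : i ∈ I <;> simp [coords, h]
  map_smul' c v := by
    funext i
    by_cases h : i ∈ I <;> simp [coords, h]

theorem coords_dot (I : Finset (Fin n)) (v : I → ZMod 2) (x : F2Vec n) :
    coords I v ⬝ᵥ x = v ⬝ᵥ restr I x := by
  have h : ∑ i ∈ I, coords I v i * x i = coords I v ⬝ᵥ x :=
    Finset.sum_subset (Finset.subset_univ I) fun i _ hi => by simp [coords, hi]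
  rw [← h, ← Finset.sum_coe_sort I fun i => coords I v i * x i]
  exact Finset.sum_congr rfl fun i _ => by simp [coords, restr]

theorem imageDir_eq {L M : AffSub (F2Vec n) k} {π : Equiv.Perm (F2Vec n)}
    (h : (M.1 : Set (F2Vec n)) = π '' (L.1 : Set (F2Vec n))) :
    imageDir π L.1 = M.1.direction := by
  rw [imageDir, ← h, AffineSubspace.direction_eq_vectorSpan]

theorem mem_orth_iff (M : AffSub (F2Vec n) k) (z : F2Vec n) :
    z ∈ orth M.1.direction ↔ tr (frame M).linear z = 0 := by
  rw [tr_eq_zero_iff, ← range_frame_linear]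
  constructor
  · intro h w
    rw [dotProduct_comm]
    exact h _ ⟨w, rfl⟩
  · rintro h _ ⟨w, rfl⟩
    rw [dotProduct_comm]
    exact h w

theorem tr_coords_injective {M : AffSub (F2Vec n) k} {I : Finset (Fin n)}
    (hI : IsInfoSet I M.1.direction) :
    Function.Injective (tr (frame M).linear ∘ₗ coordsLin I) := by
  rw [← LinearMap.ker_eq_bot, LinearMap.ker_eq_bot']
  intro v hv
  refine dotProduct_eq _ _ fun w => ?_
  obtain ⟨x, hx, hxw⟩ := hI.2 w
  obtain rfl : restr I x = w := funext hxw
  rw [zero_dotProduct, ← coords_dot, dotProduct_comm]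
  exact (mem_orth_iff M _).2 hv x hx

theorem tr_coords_bijective {M : AffSub (F2Vec n) k} {I : Finset (Fin n)}
    (hI : IsInfoSet I M.1.direction) :
    Function.Bijective (tr (frame M).linear ∘ₗ coordsLin I) := by
  have hinj := tr_coords_injective hI
  refine ⟨hinj, (LinearMap.injective_iff_surjective_of_finrank_eq_finrank ?_).1 hinj⟩
  rw [finrank_fintype_fun_eq_card, finrank_fin_fun, Fintype.card_coe, hI.1, M.2.2]

theorem frameSet_eq_subspaceConstr {L M : AffSub (F2Vec n) k} {I : Finset (Fin n)}
    {H : F2Vec n → (I → ZMod 2)} {h : F2Vec k →ᵃ[ZMod 2] F2Vec k}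
    (hh : ∀ t, h t = tr (frame M).linear (coords I (H (frame L t)))) :
    frameSet L M h = subspaceConstr (L.1 : Set (F2Vec n)) (orth M.1.direction) I H := by
  ext ⟨x, y⟩
  constructor
  · rintro ⟨t, rfl, hx⟩
    refine ⟨_, frame_mem L t, x - coords I (H (frame L t)), ?_, by simp⟩
    rw [mem_orth_iff, map_sub, ← hh, ← hx, sub_self]
  · rintro ⟨y, hy, z, hz, e⟩
    obtain ⟨rfl, rfl⟩ := Prod.mk.injEq .. ▸ e
    rw [← range_frame] at hy
    obtain ⟨t, rfl⟩ := hy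
    rw [mem_frameSet, map_add, (mem_orth_iff M z).1 hz, add_zero, hh]

theorem dot_restr_frame {L M : AffSub (F2Vec n) k} {I : Finset (Fin n)}
    {π : Equiv.Perm (F2Vec n)} {t w : F2Vec k} (hπ : π (frame L t) = frame M w)
    (v : I → ZMod 2) :
    v ⬝ᵥ restr I (π (frame L t)) =
      tr (frame M).linear (coords I v) ⬝ᵥ w + coordsLin I v ⬝ᵥ frame M 0 := by
  rw [← coords_dot, hπ, dot_frame]
  rfl

theorem image_frame_eq {L M : AffSub (F2Vec n) k} {π : Equiv.Perm (F2Vec n)}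
    {α : Equiv.Perm (F2Vec k)} (hα : ∀ t, π (frame L t) = frame M (α t)) :
    (M.1 : Set (F2Vec n)) = π '' (L.1 : Set (F2Vec n)) := by
  rw [← range_frame, ← range_frame, ← Set.range_comp]
  ext z
  constructor
  · rintro ⟨t, rfl⟩
    exact ⟨α.symm t, by rw [Function.comp_apply, hα, Equiv.apply_symm_apply]⟩
  · rintro ⟨t, rfl⟩
    exact ⟨α t, (hα t).symm⟩

/-- By `tr_coords_bijective`, `H` and `h` determine each other on `L`. The two affinity conditions
differ by the inner product of the extension of `H` by zero with `frame M 0`, which is affine. -/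
theorem nearDim_eq {ι : Submodule (ZMod 2) (F2Vec n) → Finset (Fin n)}
    (hι : ∀ R, IsInfoSet (ι R) R) : nearDim ι k = nearFrame n k Set.univ := by
  ext g
  rw [mem_nearFrame]
  constructor
  · rintro ⟨π, φ, L', ⟨hL', M', hM', hM⟩, H, hH, hG, rfl⟩
    let L : AffSub (F2Vec n) k := ⟨L', hL'⟩
    let M : AffSub (F2Vec n) k := ⟨M', hM'⟩
    have hdir : imageDir π L' = M.1.direction := imageDir_eq (L := L) (M := M) hM
    obtain ⟨α, hα⟩ := exists_perm_frame (L := L) (M := M) (π := π) fun t => by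
      rw [← SetLike.mem_coe, hM]
      exact ⟨_, frame_mem L t, rfl⟩
    -- The type of `H` depends on `imageDir π L'`, so this submodule is made a variable before
    -- substituting the direction of `M`.
    generalize imageDir π L' = R at *
    subst hdir
    obtain ⟨H₀, hH₀⟩ := (affineOn_iff_frame L H).1 hH
    obtain ⟨G₀, hG₀⟩ := (affineOn_iff_frame L _).1 hG
    let d : F2Vec n →ₗ[ZMod 2] ZMod 2 := (dotProductBilin (ZMod 2) (ZMod 2)).flip (frame M 0)
    let h : F2Vec k →ᵃ[ZMod 2] F2Vec k :=
      (tr (frame M).linear ∘ₗ coordsLin (ι M.1.direction)).toAffineMap.comp H₀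
    have hh : ∀ t, h t = tr (frame M).linear (coords (ι M.1.direction) (H (frame L t))) := by
      intro t
      rw [hH₀]
      rfl
    refine ⟨L, M, α, trivial, h, G₀ + (d ∘ₗ coordsLin (ι M.1.direction)).toAffineMap.comp H₀, π, φ,
      hα, fun t => ?_, by rw [frameSet_eq_subspaceConstr hh]⟩
    have h1 := hG₀ t
    rw [dot_restr_frame (hα t), ← hh] at h1
    change _ = G₀ t + coordsLin (ι M.1.direction) (H₀ t) ⬝ᵥ frame M 0 + _
    rw [← hH₀, ← h1]
    have q1 := add_self_zmod_two (coordsLin (ι M.1.direction) (H (frame L t)) ⬝ᵥ frame M 0)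
    have q2 := add_self_zmod_two (h t ⬝ᵥ α t)
    linear_combination -q1 - q2
  · rintro ⟨L, M, α, -, h, G, π, φ, hα, hφ, rfl⟩
    have hM := image_frame_eq hα
    refine ⟨π, φ, L.1, ⟨L.2, M.1, M.2, hM⟩, ?_⟩
    rw [imageDir_eq hM]
    let c := LinearEquiv.ofBijective _ (tr_coords_bijective (hι M.1.direction))
    obtain ⟨g, hg⟩ := exists_affine_leftInverse (frame_injective L)
    let H₀ : F2Vec k →ᵃ[ZMod 2] (ι M.1.direction → ZMod 2) :=
      c.symm.toLinearMap.toAffineMap.comp h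
    have hH : ∀ t, H₀.comp g (frame L t) = H₀ t := fun t => by rw [AffineMap.comp_apply, hg]
    have hh : ∀ t, h t = tr (frame M).linear
        (coords (ι M.1.direction) (H₀.comp g (frame L t))) := by
      intro t
      rw [hH]
      exact (c.apply_symm_apply (h t)).symm
    let d : F2Vec n →ₗ[ZMod 2] ZMod 2 := (dotProductBilin (ZMod 2) (ZMod 2)).flip (frame M 0)
    refine ⟨H₀.comp g, ⟨H₀.comp g, fun _ _ => rfl⟩, ?_, by rw [frameSet_eq_subspaceConstr hh]⟩
    rw [affineOn_iff_frame]
    refine ⟨G + (d ∘ₗ coordsLin (ι M.1.direction)).toAffineMap.comp H₀, fun t => ?_⟩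
    rw [dot_restr_frame (hα t), ← hh, hφ, hH]
    change _ = G t + coordsLin (ι M.1.direction) (H₀ t) ⬝ᵥ frame M 0
    have q2 := add_self_zmod_two (h t ⬝ᵥ α t)
    linear_combination q2

theorem ncard_nearFrame (hk : 2 ≤ k) {B : Set (Equiv.Perm (F2Vec k))}
    (hB : 3 ≤ k ∨ B.Subsingleton) : (nearFrame n k B).ncard = Nat.card (Datum n k B) := by
  rw [nearFrame, ← Nat.card_coe_set_eq]
  exact (Nat.card_congr (Equiv.ofInjective _ (Datum.fn_injective hk hB))).symm

theorem ncard_nearClass (n : ℕ) :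
    (nearClass (MM n)).ncard = ∑ k ∈ Finset.Icc 2 n, (nearFrame n k Set.univ).ncard := by
  rw [nearClass_eq, ← finsum_mem_coe_finset]
  refine Set.Finite.ncard_biUnion (Finset.finite_toSet _) (fun _ _ => Set.toFinite _) ?_
  intro k hk k' hk' hne
  exact nearFrame_disjoint (Finset.mem_Icc.1 hk).1 (Finset.mem_Icc.1 hk').1 hne _ _

theorem ncard_spClass (n : ℕ) :
    (spClass (MM n)).ncard = (nearClass (MM n)).ncard + (MM n).ncard :=
  (Set.ncard_sdiff_add_ncard_of_subset (MM_subset_spClass n) (Set.toFinite _)).symm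

end InfoSet

end MMBent

end

/-! ### Assembly of the counts. -/

theorem mainTheorem2 :
    (MMBent.nearClass (MMBent.MM 1)).ncard = 0 ∧
    (∀ n : ℕ, 2 ≤ n →
      ((MMBent.nearClass (MMBent.MM n)).ncard : ℚ) =
        (4 / 3 * MMBent.rho n 2 +
          ∑ k ∈ Finset.Icc 3 n,
            MMBent.rho n k * (2 : ℚ) ^ (((k : ℤ) + 1) ^ 2 - (2 : ℤ) ^ k)) *
          ((MMBent.MM n).ncard : ℚ)) ∧
    (∀ n : ℕ, 1 ≤ n →
      (MMBent.spClass (MMBent.MM n)).ncard =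
        (MMBent.nearClass (MMBent.MM n)).ncard + (MMBent.MM n).ncard) ∧
    (∀ n : ℕ, 2 ≤ n →
      ∀ ι : Submodule (ZMod 2) (MMBent.F2Vec n) → Finset (Fin n),
        (∀ R, MMBent.IsInfoSet (ι R) R) →
          MMBent.nearDim ι 2 ⊆ MMBent.nearClass (MMBent.MM n) ∧
          ((MMBent.nearDim ι 2).ncard : ℚ) =
            4 / 3 * MMBent.rho n 2 * ((MMBent.MM n).ncard : ℚ)) := by
  have card_two : ∀ n : ℕ, 2 ≤ n → ((MMBent.nearFrame n 2 Set.univ).ncard : ℚ) =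
      4 / 3 * MMBent.rho n 2 * ((MMBent.MM n).ncard : ℚ) := by
    intro n hn
    -- With the identity as the only bijection the data are counted without repetition; the factor
    -- is `1/24 · 2^(9-4) = 4/3`.
    rw [MMBent.nearFrame_two_eq, MMBent.ncard_nearFrame le_rfl (Or.inr Set.subsingleton_singleton),
      MMBent.cast_natCard_datum hn, Set.ncard_singleton]
    have h1 : ((2 ^ 2).factorial : ℚ) = 24 := by norm_num [Nat.factorial]
    have h2 : (2 : ℚ) ^ ((((2 : ℕ) : ℤ) + 1) ^ 2 - (2 : ℤ) ^ 2) = 32 := by norm_num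
    rw [h1, h2]
    push_cast
    ring
  refine ⟨?_, fun n hn => ?_, fun n _ => ?_, fun n hn ι hι => ⟨?_, ?_⟩⟩
  -- For `n = 1` the range of dimensions from 2 to `n` is empty.
  · rw [MMBent.nearClass_eq]
    simp
  · rw [MMBent.ncard_nearClass, Nat.cast_sum,
      ← Finset.add_sum_Ioc_eq_sum_Icc hn, card_two n hn, add_mul, Finset.sum_mul]
    congr 1
    refine Finset.sum_congr (Finset.Icc_add_one_left_eq_Ioc 2 n).symm fun k hk => ?_
    rw [Finset.mem_Icc] at hk
    rw [MMBent.ncard_nearFrame (by omega) (Or.inl hk.1), MMBent.cast_natCard_datum hk.2,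
      Set.ncard_univ, Nat.card_perm]
    have h1 : Nat.card (MMBent.F2Vec k) = 2 ^ k := by simp
    rw [h1, div_self (by positivity), mul_one]
  · exact MMBent.ncard_spClass n
  · rw [MMBent.nearDim_eq hι, MMBent.nearClass_eq]
    exact Set.subset_biUnion_of_mem (u := fun k => MMBent.nearFrame n k Set.univ)
      (Finset.mem_coe.2 (Finset.mem_Icc.2 ⟨le_rfl, hn⟩))
  · rw [MMBent.nearDim_eq hι, card_two n hn]
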